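/- Let $K$ be a field of characteristic zero (for instance $\mathbb{Q}$ or $\mathbb{R}$). Let $\Lambda$ be the ring of symmetric functions over $K$ in countably many variables $x_1,x_2,\dots$ (symmetric formal power series of bounded degree), and let $\hat\Lambda$ be its completion (all symmetric formal power series). Let $h_n\in\Lambda$ be the complete homogeneous symmetric functions, with $h_0=1$ and $h_n=0$ for $n<0$. For a partition $\lambda=(\lambda_1\ge\dots\ge\lambda_\ell>0)$ let $s_\lambda=\det(h_{\lambda_i-i+j})_{1\le i,j\le \ell}$ be the Schur function, and let $sp_\lambda$ be the symplectic universal character of Koike and Terada, that is, the $\ell\times\ell$ determinant whose entry in row $i$ is $h_{\lambda_i-i+1}$ in column $1$ and $h_{\lambda_i-i+j}+h_{\lambda_i-i-j+2}$ in column $j\ge2$. The Schur functions form a $K$-basis of $\Lambda$. Let $\langle\cdot,\cdot\rangle$ be the bilinear form on $\Lambda$ for which they are orthonormal, extended to a pairing $\Lambda\times\hat\Lambda\to K$ by letting $\langle s_\lambda,g\rangle$ be the coefficient of $s_\lambda$ in the expansion of $g\in\hat\Lambda$ as a formal infinite sum of Schur functions. **Theorem.** Let $p(x)=1+a_1x+a_2x^2+\cdots\in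 K[[x]]$ be a formal power series (for example a polynomial) with $p(0)=1$, put $a_0=1$, and define $$\kappa_p=\frac{\prod_{i\ge1}p(x_i)}{\prod_{1\le i<j}(1-x_ix_j)}\in\hat\Lambda .$$ Then there is a unique linear map $\kappa_p^\perp:\Lambda\to\Lambda$ with $\langle\kappa_p^\perp u,v\rangle=\langle u,\kappa_p v\rangle$ for all $u\in\Lambda$, $v\in\hat\Lambda$ (skewing by $\kappa_p$, the adjoint to multiplication by $\kappa_p$). Let $\Phi:\Lambda\to\Lambda$ be the linear map with $\Phi(s_\mu)=sp_\mu$ for all $\mu$. Then the linear map $f_p:\Lambda\to\Lambda$ defined by $f_p(s_\lambda)=\Phi(\kappa_p^\perp s_\lambda)$ is a ring homomorphism. In fact $f_p$ is a $K$-algebra automorphism of $\Lambda$, and it is the unique $K$-algebra endomorphism of $\Lambda$ with $$h_n\mapsto \sum_{i=0}^{n}a_i h_{n-i}=h_n+a_1h_{n-1}+\cdots+a_{n-1}h_1+a_n\qquad(n\ge0).$$ -/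

import Mathlib

noncomputable section

namespace SymFun

variable (K : Type*) [Field K]

/-- The completed ring of symmetric functions in the countably many variables `x_0, x_1, x_2, …`:
all formal power series that are invariant under every permutation of the variables. -/
def LambdaHat : Subalgebra K (MvPowerSeries ℕ K) where
  carrier := {f | ∀ σ : Equiv.Perm ℕ, MvPowerSeries.rename σ f = f}
  mul_mem' hf hg σ := by rw [map_mul, hf σ, hg σ]
  add_mem' hf hg σ := by rw [map_add, hf σ, hg σ]
  algebraMap_mem' r σ := AlgHom.commutes _ r

/-- The ring of symmetric functions: the symmetric formal power series of bounded degree. -/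
def Lambda : Subalgebra K (MvPowerSeries ℕ K) where
  carrier := {f | f ∈ LambdaHat K ∧
    ∃ N : ℕ, ∀ d : ℕ →₀ ℕ, N < d.degree → MvPowerSeries.coeff d f = 0}
  mul_mem' := by
    rintro f g ⟨hf, M, hM⟩ ⟨hg, N, hN⟩
    refine ⟨mul_mem hf hg, M + N, fun d hd => ?_⟩
    classical
    rw [MvPowerSeries.coeff_mul]
    refine Finset.sum_eq_zero fun e he => ?_
    have h1 : e.1.degree + e.2.degree = d.degree := by
      rw [← map_add, Finset.HasAntidiagonal.mem_antidiagonal.mp he]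
    by_cases h : M < e.1.degree
    · rw [hM _ h, zero_mul]
    · rw [hN e.2 (by omega), mul_zero]
  add_mem' := by
    rintro f g ⟨hf, M, hM⟩ ⟨hg, N, hN⟩
    refine ⟨add_mem hf hg, M + N, fun d hd => ?_⟩
    rw [map_add, hM d (by omega), hN d (by omega), add_zero]
  algebraMap_mem' r := by
    refine ⟨(LambdaHat K).algebraMap_mem r, 0, fun d hd => ?_⟩
    classical
    rw [MvPowerSeries.algebraMap_apply, MvPowerSeries.coeff_C, if_neg]
    rintro rfl
    simp at hd

variable {K}

theorem mem_LambdaHat_iff (f : MvPowerSeries ℕ K) :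
    f ∈ LambdaHat K ↔ ∀ (σ : Equiv.Perm ℕ) (d : ℕ →₀ ℕ),
      MvPowerSeries.coeff (Finsupp.mapDomain σ d) f = MvPowerSeries.coeff d f := by
  have key : ∀ (σ : Equiv.Perm ℕ) (d : ℕ →₀ ℕ),
      MvPowerSeries.coeff (Finsupp.mapDomain σ d) (MvPowerSeries.rename σ f)
        = MvPowerSeries.coeff d f := by
    intro σ d
    have := MvPowerSeries.coeff_embDomain_rename (σ.toEmbedding) f d
    rw [Finsupp.embDomain_eq_mapDomain] at this
    exact this
  constructor
  · intro h σ d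
    conv_lhs => rw [← h σ]
    exact key σ d
  · intro h σ
    ext d
    obtain ⟨e, rfl⟩ : ∃ e, Finsupp.mapDomain σ e = d :=
      ⟨Finsupp.mapDomain σ.symm d, by
        rw [← Finsupp.mapDomain_comp]; simp⟩
    rw [key, h]

variable (K)

/-- The complete homogeneous symmetric function `h_n`: the sum of all monomials of degree `n`. -/
def h (n : ℕ) : Lambda K :=
  ⟨fun d => if d.degree = n then 1 else 0, by
    have hc : ∀ d : ℕ →₀ ℕ, MvPowerSeries.coeff d
        (fun d => if d.degree = n then 1 else 0 : MvPowerSeries ℕ K)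
          = if d.degree = n then 1 else 0 := fun d => rfl
    refine ⟨(mem_LambdaHat_iff _).mpr fun σ d => ?_, n, fun d hd => ?_⟩
    · rw [hc, hc, Finsupp.degree_mapDomain]
    · rw [hc, if_neg (by omega)]⟩

/-- `h_k` for an integer index, with `h_k = 0` for `k < 0`. -/
def hInt (k : ℤ) : Lambda K := if 0 ≤ k then h K k.toNat else 0

/-- The Schur function `s_λ = det (h_{λ_i - i + j})`, where `λ` has `ℓ = μ.colLen 0` parts
(rows and columns are numbered from `0`). -/
def schur (μ : YoungDiagram) : Lambda K :=
  Matrix.det (Matrix.of fun i j : Fin (μ.colLen 0) =>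
    hInt K ((μ.rowLen i : ℤ) - (i : ℤ) + (j : ℤ)))

/-- The symplectic universal character `sp_λ` of Koike and Terada: the determinant whose
column `j = 0` is `h_{λ_i - i}` and whose column `j ≥ 1` is `h_{λ_i - i + j} + h_{λ_i - i - j}`
(rows and columns are numbered from `0`). -/
def sp (μ : YoungDiagram) : Lambda K :=
  Matrix.det (Matrix.of fun i j : Fin (μ.colLen 0) =>
    if (j : ℕ) = 0 then hInt K ((μ.rowLen i : ℤ) - (i : ℤ))
    else hInt K ((μ.rowLen i : ℤ) - (i : ℤ) + (j : ℤ))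
      + hInt K ((μ.rowLen i : ℤ) - (i : ℤ) - (j : ℤ)))

variable {K}

/-- The homogeneous component of degree `n` of an element of the completion. -/
def component (n : ℕ) : LambdaHat K →ₗ[K] Lambda K where
  toFun f := ⟨MvPowerSeries.homogeneousComponent n (f : MvPowerSeries ℕ K), by
    refine ⟨(mem_LambdaHat_iff _).mpr fun σ d => ?_, n, fun d hd => ?_⟩
    · rw [MvPowerSeries.coeff_homogeneousComponent, MvPowerSeries.coeff_homogeneousComponent,
        Finsupp.degree_mapDomain, (mem_LambdaHat_iff _).mp f.2]
    · rw [MvPowerSeries.coeff_homogeneousComponent, if_neg (by omega)]⟩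
  map_add' f g := Subtype.ext (by simp)
  map_smul' c f := Subtype.ext (by simp)

/-- Given the Schur basis `s`, the standard pairing `⟨f, g⟩` of a symmetric function `f` with
an element `g` of the completion: it is linear in `f`, and `⟨s_λ, g⟩` is the coefficient
of `s_λ` in the Schur expansion of `g`, read off in the component of `g` of degree `|λ|`.
On `Λ × Λ` this is the bilinear form for which the Schur functions are orthonormal. -/
def pairing (s : Module.Basis YoungDiagram K (Lambda K)) :
    Lambda K →ₗ[K] LambdaHat K →ₗ[K] K :=
  s.constr K fun μ => s.coord μ ∘ₗ component μ.card

/-- Given the Schur basis `s`, the linear map `s_μ ↦ sp_μ`. -/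
def schurToSp (s : Module.Basis YoungDiagram K (Lambda K)) : Lambda K →ₗ[K] Lambda K :=
  s.constr K (sp K)

/-- The analogue of `κ_p` in the finitely many variables `x_i`, `i ∈ S`:
`∏_{i ∈ S} p(x_i) / ∏_{i < j, i, j ∈ S} (1 - x_i x_j)`. -/
def kappaFin (p : PowerSeries K) (S : Finset ℕ) : MvPowerSeries ℕ K :=
  (∏ i ∈ S, p.subst (MvPowerSeries.X i : MvPowerSeries ℕ K)) *
    (∏ ij ∈ (S ×ˢ S).filter (fun ij => ij.1 < ij.2),
      (1 - MvPowerSeries.X ij.1 * MvPowerSeries.X ij.2 : MvPowerSeries ℕ K))⁻¹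

/-- The infinite product `κ_p = ∏_i p(x_i) / ∏_{i<j} (1 - x_i x_j)` as a formal power series.
Its coefficient at a monomial is computed from the variables that occur in this monomial; by
`coeff_kappaSeries` below, when `p(0) = 1` this is the stable value of the coefficients of the
finite products. -/
def kappaSeries (p : PowerSeries K) : MvPowerSeries ℕ K :=
  fun d => MvPowerSeries.coeff d (kappaFin p d.support)

theorem constantCoeff_den (T : Finset (ℕ × ℕ)) : MvPowerSeries.constantCoeff
    (∏ ij ∈ T, (1 - MvPowerSeries.X ij.1 * MvPowerSeries.X ij.2 : MvPowerSeries ℕ K)) = 1 := by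
  rw [map_prod]
  exact Finset.prod_eq_one fun ij _ => by simp

theorem X_dvd_kappaFin_insert (p : PowerSeries K) (hp : PowerSeries.constantCoeff p = 1)
    (a : ℕ) (T : Finset ℕ) (ha : a ∉ T) :
    (MvPowerSeries.X a : MvPowerSeries ℕ K) ∣ kappaFin p (insert a T) - kappaFin p T := by
  have hX : ∀ f g : MvPowerSeries ℕ K, MvPowerSeries.X a ∣ f - g ↔
      Ideal.Quotient.mk (Ideal.span {(MvPowerSeries.X a : MvPowerSeries ℕ K)}) f =
        Ideal.Quotient.mk (Ideal.span {(MvPowerSeries.X a : MvPowerSeries ℕ K)}) g := by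
    intro f g
    rw [Ideal.Quotient.eq, Ideal.mem_span_singleton]
  rw [hX]
  set q := Ideal.Quotient.mk (Ideal.span {(MvPowerSeries.X a : MvPowerSeries ℕ K)})
  have hqX : q (MvPowerSeries.X a) = 0 :=
    Ideal.Quotient.eq_zero_iff_mem.mpr (Ideal.mem_span_singleton_self _)
  have hqp : q (p.subst (MvPowerSeries.X a : MvPowerSeries ℕ K)) = 1 := by
    rw [← map_one q, ← hX, MvPowerSeries.X_dvd_iff]
    intro m hm
    classical
    rw [map_sub, PowerSeries.coeff_subst_single, MvPowerSeries.coeff_one, hm,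
      Finsupp.single_zero]
    split_ifs <;> simp [hp]
  have hden : q (∏ ij ∈ (insert a T ×ˢ insert a T).filter (fun ij => ij.1 < ij.2),
        (1 - MvPowerSeries.X ij.1 * MvPowerSeries.X ij.2 : MvPowerSeries ℕ K))
      = q (∏ ij ∈ (T ×ˢ T).filter (fun ij => ij.1 < ij.2),
        (1 - MvPowerSeries.X ij.1 * MvPowerSeries.X ij.2 : MvPowerSeries ℕ K)) := by
    rw [map_prod, map_prod]
    symm
    refine Finset.prod_subset (fun ij hij => ?_) fun ij hij hij' => ?_
    · simp only [Finset.mem_filter, Finset.mem_product, Finset.mem_insert] at hij ⊢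
      tauto
    · simp only [Finset.mem_filter, Finset.mem_product, Finset.mem_insert] at hij hij'
      have : ij.1 = a ∨ ij.2 = a := by tauto
      rcases this with h | h <;> simp [h, hqX]
  have hmul : ∀ S : Finset ℕ, q (kappaFin p S) *
      q (∏ ij ∈ (S ×ˢ S).filter (fun ij => ij.1 < ij.2),
        (1 - MvPowerSeries.X ij.1 * MvPowerSeries.X ij.2 : MvPowerSeries ℕ K))
      = q (∏ i ∈ S, p.subst (MvPowerSeries.X i : MvPowerSeries ℕ K)) := by
    intro S
    rw [← map_mul, kappaFin, mul_assoc, MvPowerSeries.inv_mul_cancel, mul_one]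
    rw [constantCoeff_den]
    exact one_ne_zero
  have hunit : IsUnit (q (∏ ij ∈ (T ×ˢ T).filter (fun ij => ij.1 < ij.2),
      (1 - MvPowerSeries.X ij.1 * MvPowerSeries.X ij.2 : MvPowerSeries ℕ K))) := by
    apply IsUnit.map
    rw [MvPowerSeries.isUnit_iff_constantCoeff, constantCoeff_den]
    exact isUnit_one
  refine hunit.mul_left_injective ?_
  change q (kappaFin p (insert a T)) * _ = q (kappaFin p T) * _
  rw [hmul T]
  conv_lhs => rw [← hden]
  rw [hmul, Finset.prod_insert ha, map_mul, hqp, one_mul]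

/-- The infinite product converges: each coefficient of `κ_p` is the coefficient of all
finite products over sufficiently many variables. -/
theorem coeff_kappaSeries (p : PowerSeries K) (hp : PowerSeries.constantCoeff p = 1)
    (d : ℕ →₀ ℕ) (S : Finset ℕ) (hS : d.support ⊆ S) :
    MvPowerSeries.coeff d (kappaFin p S) = MvPowerSeries.coeff d (kappaSeries p) := by
  change _ = MvPowerSeries.coeff d (kappaFin p d.support)
  have key : ∀ R : Finset ℕ, MvPowerSeries.coeff d (kappaFin p (R ∪ d.support))
      = MvPowerSeries.coeff d (kappaFin p d.support) := by
    intro R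
    induction R using Finset.induction_on with
    | empty => rw [Finset.empty_union]
    | insert a R _ ih =>
      rw [Finset.insert_union]
      by_cases ha : a ∈ R ∪ d.support
      · rw [Finset.insert_eq_of_mem ha, ih]
      · rw [← ih, ← sub_eq_zero, ← map_sub]
        refine MvPowerSeries.X_dvd_iff.mp (X_dvd_kappaFin_insert p hp a _ ha) d ?_
        rw [Finset.mem_union, not_or] at ha
        exact Finsupp.notMem_support_iff.mp ha.2
  have := key S
  rwa [Finset.union_eq_left.mpr hS] at this

theorem rename_subst_X (p : PowerSeries K) (σ : Equiv.Perm ℕ) (i : ℕ) :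
    MvPowerSeries.rename σ (p.subst (MvPowerSeries.X i : MvPowerSeries ℕ K))
      = p.subst (MvPowerSeries.X (σ i) : MvPowerSeries ℕ K) := by
  ext d
  obtain ⟨e, rfl⟩ : ∃ e, Finsupp.mapDomain σ e = d :=
    ⟨Finsupp.mapDomain σ.symm d, by rw [← Finsupp.mapDomain_comp]; simp⟩
  have h1 := MvPowerSeries.coeff_embDomain_rename (σ.toEmbedding)
    (p.subst (MvPowerSeries.X i : MvPowerSeries ℕ K)) e
  rw [Finsupp.embDomain_eq_mapDomain] at h1
  refine h1.trans ?_
  rw [PowerSeries.coeff_subst_single, PowerSeries.coeff_subst_single,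
    Finsupp.mapDomain_apply σ.injective]
  have : (Finsupp.mapDomain σ e = Finsupp.single (σ i) (e i)) ↔ e = Finsupp.single i (e i) := by
    rw [← Finsupp.mapDomain_single (f := σ)]
    exact (Finsupp.mapDomain_injective σ.injective).eq_iff
  simp only [this]

theorem rename_den (σ : Equiv.Perm ℕ) (S : Finset ℕ) :
    MvPowerSeries.rename σ (∏ ij ∈ (S ×ˢ S).filter (fun ij => ij.1 < ij.2),
        (1 - MvPowerSeries.X ij.1 * MvPowerSeries.X ij.2 : MvPowerSeries ℕ K))
      = ∏ ij ∈ (S.map σ.toEmbedding ×ˢ S.map σ.toEmbedding).filter (fun ij => ij.1 < ij.2),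
        (1 - MvPowerSeries.X ij.1 * MvPowerSeries.X ij.2 : MvPowerSeries ℕ K) := by
  rw [map_prod]
  refine Finset.prod_bij'
    (fun ij _ => if σ ij.1 < σ ij.2 then (σ ij.1, σ ij.2) else (σ ij.2, σ ij.1))
    (fun ij _ => if σ.symm ij.1 < σ.symm ij.2 then (σ.symm ij.1, σ.symm ij.2)
      else (σ.symm ij.2, σ.symm ij.1)) ?_ ?_ ?_ ?_ ?_
  · rintro ⟨i, j⟩ hij
    simp only [Finset.mem_filter, Finset.mem_product] at hij
    have hne : σ i ≠ σ j := fun h => hij.2.ne (σ.injective h)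
    split_ifs with h
    · simp [hij, h]
    · simp only [Finset.mem_filter, Finset.mem_product, Finset.mem_map_equiv,
        Equiv.symm_apply_apply]
      exact ⟨⟨hij.1.2, hij.1.1⟩, by simp only at h; omega⟩
  · rintro ⟨i, j⟩ hij
    simp only [Finset.mem_filter, Finset.mem_product, Finset.mem_map_equiv] at hij
    have hne : σ.symm i ≠ σ.symm j := fun h => hij.2.ne (σ.symm.injective h)
    split_ifs with h
    · simp only [Finset.mem_filter, Finset.mem_product]
      exact ⟨hij.1, h⟩
    · simp only [Finset.mem_filter, Finset.mem_product]
      exact ⟨⟨hij.1.2, hij.1.1⟩, by simp only at h; omega⟩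
  · rintro ⟨i, j⟩ hij
    simp only [Finset.mem_filter, Finset.mem_product] at hij
    have h1 := hij.2
    have h2 : ¬ j < i := by omega
    by_cases h : σ i < σ j <;> simp [h, h1, h2]
  · rintro ⟨i, j⟩ hij
    simp only [Finset.mem_filter, Finset.mem_product] at hij
    have h1 := hij.2
    have h2 : ¬ j < i := by omega
    by_cases h : σ.symm i < σ.symm j <;> simp [h, h1, h2]
  · rintro ⟨i, j⟩ hij
    by_cases h : σ i < σ j <;> simp [h, mul_comm]

theorem rename_kappaFin (p : PowerSeries K) (σ : Equiv.Perm ℕ) (S : Finset ℕ) :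
    MvPowerSeries.rename σ (kappaFin p S) = kappaFin p (S.map σ.toEmbedding) := by
  rw [kappaFin, kappaFin, map_mul, map_prod, Finset.prod_map]
  congr 1
  · exact Finset.prod_congr rfl fun i _ => rename_subst_X p σ i
  · rw [MvPowerSeries.eq_inv_iff_mul_eq_one (by rw [constantCoeff_den]; exact one_ne_zero),
      ← rename_den, ← map_mul, MvPowerSeries.inv_mul_cancel, map_one]
    rw [constantCoeff_den]
    exact one_ne_zero

/-- `κ_p` as an element of the completed ring of symmetric functions. -/
def kappa (p : PowerSeries K) : LambdaHat K :=
  ⟨kappaSeries p, by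
    refine (mem_LambdaHat_iff _).mpr fun σ d => ?_
    have hc : ∀ d : ℕ →₀ ℕ, MvPowerSeries.coeff d (kappaSeries p)
      = MvPowerSeries.coeff d (kappaFin p d.support) := fun d => rfl
    have hs : (Finsupp.mapDomain σ d).support = d.support.map σ.toEmbedding := by
      have := Finsupp.support_embDomain σ.toEmbedding d
      rwa [Finsupp.embDomain_eq_mapDomain] at this
    rw [hc, hc, hs, ← rename_kappaFin]
    have := MvPowerSeries.coeff_embDomain_rename (σ.toEmbedding) (kappaFin p d.support) d
    rw [Finsupp.embDomain_eq_mapDomain] at this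
    exact this⟩

/-- `A` is the skewing operator `g^⊥`, the adjoint to multiplication by `g ∈ Λ̂` with respect to
the pairing of `Λ` with `Λ̂`. -/
def IsSkewing (s : Module.Basis YoungDiagram K (Lambda K)) (g : LambdaHat K)
    (A : Lambda K →ₗ[K] Lambda K) : Prop :=
  ∀ (u : Lambda K) (v : LambdaHat K), pairing s (A u) v = pairing s u (g * v)

end SymFun

end

/-! The proof is a Cauchy-type identity in auxiliary variables y_1, …, y_N with coefficients in Λ.
Write a_{λ+δ}(y) for the alternants and H(t) = ∑ h_n t^n. The coefficient of y^(λ+δ) in a_δ(y) ∏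
H(y_i) is the Jacobi-Trudi determinant s_λ. With the columns y^(N-1-j) replaced by the family
y^(N-1)(y^j + y^(-j)) (and y^(N-1) for j = 0), the same coefficient becomes sp_λ.

The alternant of that family is a_δ(y) ∏_{i<j} (1 - y_i y_j) (`alternant_symplecticFamily`). Hence
a_δ(y) ∏_{i<j} (1 - y_i y_j) ∏ H(y_i) = ∑ sp_ν a_{ν+δ}(y) up to the relevant degree. Multiplication
by κ_p(y) cancels the product over pairs and turns H into pH. In the coefficient of y^(μ+δ), the
left side is the Jacobi-Trudi determinant of pH. The right side is ∑ ⟨s_μ, κ_p s_ν⟩ sp_ν, that is,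
Φ(κ_p^⊥ s_μ) (`schurToSp_skewing_kappa`).

So f_p(s_μ) arises from s_μ by replacing H with pH. Since Λ is the polynomial ring in h_1, h_2, …
(`evalH_bijective`), this replacement is an algebra endomorphism, and the one for 1/p is its
inverse.

The Schur basis and the polynomial structure of Λ are proved by the same method: expand an
antisymmetric series in the a_{λ+δ}, then cancel a_δ. All comparisons use N variables with N at
least the degree involved. -/

noncomputable section

namespace SymFun

/-! ### Alternants and antisymmetric power series. -/

section Alternant

variable {R : Type*} [CommRing R] {N : ℕ}

/-- The determinant `det (u_j(y_i))` in the variables `y_0, …, y_{N-1}`. -/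
def alternant (u : Fin N → PowerSeries R) : MvPowerSeries (Fin N) R :=
  Matrix.det (Matrix.of fun i j => (u j).subst (MvPowerSeries.X i : MvPowerSeries (Fin N) R))

/-- The i-th factor involves only the i-th variable, so a single splitting of the exponent
contributes. -/
theorem coeff_prod_subst_X (f : Fin N → PowerSeries R) (d : Fin N →₀ ℕ) :
    MvPowerSeries.coeff d (∏ i, (f i).subst (MvPowerSeries.X i : MvPowerSeries (Fin N) R))
      = ∏ i, PowerSeries.coeff (d i) (f i) := by
  classical
  rw [MvPowerSeries.coeff_prod]
  let l : Fin N →₀ (Fin N →₀ ℕ) :=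
    Finsupp.equivFunOnFinite.symm fun i => Finsupp.single i (d i)
  have hl : ∀ i, l i = Finsupp.single i (d i) := fun i => rfl
  have hsum : ∑ i, Finsupp.single i (d i) = d := by
    ext j
    simp
  rw [Finset.sum_eq_single l]
  · refine Finset.prod_congr rfl fun i _ => ?_
    rw [PowerSeries.coeff_subst_single, hl]
    simp
  · intro m hm hne
    rw [Finset.mem_finsuppAntidiag] at hm
    by_contra hprod
    have hm' : ∀ i, m i = Finsupp.single i (m i i) := by
      intro i
      by_contra hi
      refine hprod (Finset.prod_eq_zero (Finset.mem_univ i) ?_)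
      rw [PowerSeries.coeff_subst_single, if_neg hi]
    refine hne (Finsupp.ext fun i => ?_)
    rw [hl, hm' i, ← hm.1]
    congr 1
    rw [Finsupp.finsetSum_apply, Finset.sum_eq_single i]
    · intro j _ hj
      rw [hm' j, Finsupp.single_eq_of_ne hj.symm]
    · simp
  · intro hl'
    refine absurd ?_ hl'
    rw [Finset.mem_finsuppAntidiag]
    exact ⟨by simp [hl, hsum], Finset.subset_univ _⟩

theorem coeff_alternant (u : Fin N → PowerSeries R) (d : Fin N →₀ ℕ) :
    MvPowerSeries.coeff d (alternant u)
      = Matrix.det (Matrix.of fun i j => PowerSeries.coeff (d i) (u j)) := by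
  rw [alternant, ← Matrix.det_transpose, ← Matrix.det_transpose (Matrix.of _), Matrix.det_apply,
    Matrix.det_apply, map_sum]
  refine Finset.sum_congr rfl fun σ _ => ?_
  rw [Units.smul_def, Units.smul_def, map_zsmul]
  congr 1
  exact coeff_prod_subst_X (fun i => u (σ i)) d

theorem alternant_mul (u : Fin N → PowerSeries R) (H : PowerSeries R) :
    alternant (fun j => u j * H)
      = (∏ i, H.subst (MvPowerSeries.X i : MvPowerSeries (Fin N) R)) * alternant u := by
  rw [alternant, alternant, ← Matrix.det_mul_column]
  congr 1
  ext1 i j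
  simp only [Matrix.of_apply]
  rw [PowerSeries.subst_mul (PowerSeries.HasSubst.X i), mul_comm]

/-- Antisymmetric power series. -/
def IsAntisymm (f : MvPowerSeries (Fin N) R) : Prop :=
  ∀ (σ : Equiv.Perm (Fin N)) (d e : Fin N →₀ ℕ), (∀ i, e i = d (σ i)) →
    MvPowerSeries.coeff e f = ((Equiv.Perm.sign σ : ℤ) : R) * MvPowerSeries.coeff d f

theorem isAntisymm_alternant (u : Fin N → PowerSeries R) : IsAntisymm (alternant u) := by
  intro σ d e hde
  rw [coeff_alternant, coeff_alternant, ← Matrix.det_permute]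
  congr 1
  ext i j
  simp [hde]

theorem IsAntisymm.sub {f g : MvPowerSeries (Fin N) R} (hf : IsAntisymm f) (hg : IsAntisymm g) :
    IsAntisymm (f - g) := by
  intro σ d e hde
  rw [map_sub, map_sub, hf σ d e hde, hg σ d e hde, mul_sub]

theorem IsAntisymm.smul {f : MvPowerSeries (Fin N) R} (hf : IsAntisymm f) (c : R) :
    IsAntisymm (c • f) := by
  intro σ d e hde
  rw [MvPowerSeries.coeff_smul, MvPowerSeries.coeff_smul, hf σ d e hde, mul_left_comm]

theorem IsAntisymm.sum {ι : Type*} (s : Finset ι) {f : ι → MvPowerSeries (Fin N) R}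
    (hf : ∀ i ∈ s, IsAntisymm (f i)) : IsAntisymm (∑ i ∈ s, f i) := by
  intro σ d e hde
  rw [map_sum, map_sum, Finset.mul_sum]
  exact Finset.sum_congr rfl fun i hi => hf i hi σ d e hde

theorem coeff_rename_perm (σ : Equiv.Perm (Fin N)) (f : MvPowerSeries (Fin N) R)
    (d e : Fin N →₀ ℕ) (hde : ∀ i, e i = d (σ i)) :
    MvPowerSeries.coeff d (MvPowerSeries.rename σ f) = MvPowerSeries.coeff e f := by
  have := MvPowerSeries.coeff_embDomain_rename σ.toEmbedding f e
  have hd : Finsupp.embDomain σ.toEmbedding e = d := by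
    ext i
    obtain ⟨j, rfl⟩ := σ.surjective i
    rw [← hde]
    exact Finsupp.embDomain_apply_self σ.toEmbedding e j
  rw [hd] at this
  exact this

theorem IsAntisymm.mul_symm {f g : MvPowerSeries (Fin N) R} (hf : IsAntisymm f)
    (hg : ∀ σ : Equiv.Perm (Fin N), MvPowerSeries.rename σ g = g) : IsAntisymm (f * g) := by
  intro σ d e hde
  have h1 : MvPowerSeries.rename σ f = ((Equiv.Perm.sign σ : ℤ) : R) • f := by
    ext d
    rw [coeff_rename_perm σ f d (d.equivMapDomain σ.symm) (fun i => by simp),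
      MvPowerSeries.coeff_smul]
    exact hf σ d _ fun i => by simp
  rw [← coeff_rename_perm σ _ d e hde, map_mul, hg, h1, smul_mul_assoc, MvPowerSeries.coeff_smul]

/-- Swapping two positions with equal exponents fixes the monomial and negates its coefficient. -/
theorem IsAntisymm.coeff_eq_zero [CharZero R] [NoZeroDivisors R] {f : MvPowerSeries (Fin N) R}
    (hf : IsAntisymm f) (d : Fin N →₀ ℕ) (hd : ¬ Function.Injective d) :
    MvPowerSeries.coeff d f = 0 := by
  simp only [Function.Injective, not_forall] at hd
  obtain ⟨a, b, hab, hne⟩ := hd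
  have := hf (Equiv.swap a b) d d fun i => by
    rcases eq_or_ne i a with rfl | h1
    · simpa using hab
    rcases eq_or_ne i b with rfl | h2
    · simpa using hab.symm
    rw [Equiv.swap_apply_of_ne_of_ne h1 h2]
  rw [Equiv.Perm.sign_swap hne] at this
  simpa [self_eq_neg] using this

theorem IsAntisymm.coeff_eq_zero_of_strictAnti [CharZero R] [NoZeroDivisors R]
    {f : MvPowerSeries (Fin N) R} (hf : IsAntisymm f) (m : ℕ)
    (h0 : ∀ d : Fin N →₀ ℕ, StrictAnti d → d.degree ≤ m → MvPowerSeries.coeff d f = 0)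
    (d : Fin N →₀ ℕ) (hd : d.degree ≤ m) : MvPowerSeries.coeff d f = 0 := by
  by_cases hinj : Function.Injective d
  swap
  · exact hf.coeff_eq_zero d hinj
  -- `Tuple.sort` puts the exponents in increasing order; the reversal makes them decreasing,
  -- strictly so because they are distinct.
  let σ := Fin.revPerm.trans (Tuple.sort d)
  have hanti : StrictAnti (d ∘ σ) := by
    have h1 : Antitone (d ∘ σ) := fun i j hij =>
      Tuple.monotone_sort d (Fin.rev_le_rev.mpr hij)
    exact h1.strictAnti_of_injective (hinj.comp σ.injective)
  have h2 := hf σ.symm (d.equivMapDomain σ.symm) d fun i => by simp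
  rw [h2, h0, mul_zero]
  · intro i j hij
    simpa using hanti hij
  · refine le_of_eq_of_le ?_ hd
    rw [Finsupp.degree_eq_sum, Finsupp.degree_eq_sum]
    simpa using Equiv.sum_comp σ d

end Alternant

/-! ### Partitions as strictly decreasing exponents. -/

section Exponents

/-- The exponent `λ + δ` in `N` variables. -/
def expo (N : ℕ) (μ : YoungDiagram) : Fin N →₀ ℕ :=
  Finsupp.equivFunOnFinite.symm fun i => μ.rowLen i + i.rev

@[simp]
theorem expo_apply (N : ℕ) (μ : YoungDiagram) (i : Fin N) :
    expo N μ i = μ.rowLen i + i.rev := rfl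

theorem strictAnti_expo (N : ℕ) (μ : YoungDiagram) : StrictAnti (expo N μ) := by
  intro i j hij
  have := μ.rowLen_anti i j (by exact_mod_cast hij.le)
  have h2 : (j.rev : ℕ) < i.rev := by exact_mod_cast Fin.rev_lt_rev.mpr hij
  simp only [expo_apply]
  omega

theorem colLen_le_card (μ : YoungDiagram) : μ.colLen 0 ≤ μ.card := by
  rw [YoungDiagram.colLen_eq_card]
  exact Finset.card_le_card (Finset.filter_subset _ _)

theorem rowLen_eq_zero (μ : YoungDiagram) (i : ℕ) (hi : μ.colLen 0 ≤ i) : μ.rowLen i = 0 := by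
  by_contra h0
  have := YoungDiagram.mem_iff_lt_rowLen.mpr (Nat.pos_of_ne_zero h0)
  rw [YoungDiagram.mem_iff_lt_colLen] at this
  omega

theorem eq_of_rowLen_eq {μ ν : YoungDiagram} (hμν : ∀ i, μ.rowLen i = ν.rowLen i) : μ = ν := by
  ext ⟨i, j⟩
  rw [YoungDiagram.mem_cells, YoungDiagram.mem_cells, YoungDiagram.mem_iff_lt_rowLen,
    YoungDiagram.mem_iff_lt_rowLen, hμν]

theorem sum_rowLen (N : ℕ) (μ : YoungDiagram) (hμ : μ.colLen 0 ≤ N) :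
    ∑ i : Fin N, μ.rowLen i = μ.card := by
  rw [Fin.sum_univ_eq_sum_range (fun i => μ.rowLen i) N, YoungDiagram.card,
    Finset.card_eq_sum_card_fiberwise (f := Prod.fst) (t := Finset.range N)]
  · refine Finset.sum_congr rfl fun i _ => ?_
    rw [YoungDiagram.rowLen_eq_card]
    rfl
  · rintro ⟨i, j⟩ hij
    have : (i, 0) ∈ μ := μ.up_left_mem le_rfl (Nat.zero_le j) hij
    rw [YoungDiagram.mem_iff_lt_colLen] at this
    simp only [Finset.coe_range, Set.mem_Iio]
    omega

theorem degree_expo (N : ℕ) (μ : YoungDiagram) (hμ : μ.colLen 0 ≤ N) :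
    (expo N μ).degree = μ.card + (expo N ⊥).degree := by
  rw [Finsupp.degree_eq_sum, Finsupp.degree_eq_sum]
  simp only [expo_apply]
  rw [Finset.sum_add_distrib, Finset.sum_add_distrib, sum_rowLen N μ hμ, sum_rowLen N ⊥]
  · simp
  · exact (colLen_le_card ⊥).trans (Nat.zero_le N)

theorem expo_injective (N : ℕ) {μ ν : YoungDiagram} (hμ : μ.colLen 0 ≤ N) (hν : ν.colLen 0 ≤ N)
    (h : expo N μ = expo N ν) : μ = ν := by
  refine eq_of_rowLen_eq fun i => ?_
  by_cases hi : i < N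
  · have := DFunLike.congr_fun h ⟨i, hi⟩
    simpa using this
  · rw [rowLen_eq_zero μ i (by omega), rowLen_eq_zero ν i (by omega)]

theorem exists_expo_eq {N : ℕ} (d : Fin N →₀ ℕ) (hd : StrictAnti d) :
    ∃ μ : YoungDiagram, μ.colLen 0 ≤ N ∧ expo N μ = d := by
  -- A strictly decreasing sequence drops by at least one per step, so subtracting δ leaves a weakly
  -- decreasing sequence of natural numbers.
  have hstep : ∀ i j : Fin N, i ≤ j → d j + (j - i) ≤ d i := by
    intro i j hij
    obtain ⟨k, hk⟩ := Nat.exists_eq_add_of_le (show (i : ℕ) ≤ j from hij)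
    induction k generalizing j with
    | zero =>
      obtain rfl : i = j := Fin.ext (by omega)
      simp
    | succ k ih =>
      have h1 := ih ⟨i + k, by omega⟩ (Fin.le_def.mpr (by simp)) rfl
      have h2 : d j < d ⟨i + k, by omega⟩ := hd (Fin.lt_def.mpr (hk ▸ Nat.lt_succ_self _))
      simp only at h1
      omega
  have hge : ∀ i : Fin N, (i.rev : ℕ) ≤ d i := by
    intro i
    have hi := i.isLt
    have := hstep i ⟨N - 1, by omega⟩ (Fin.le_def.mpr (by simp only; omega))
    rw [Fin.val_rev]
    simp only at this
    omega
  have hsorted : (List.ofFn fun i : Fin N => d i - i.rev).SortedGE := by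
    rw [List.sortedGE_ofFn_iff]
    intro i j hij
    have := hstep i j hij
    have h1 := hge i
    have h2 := hge j
    have h3 := Fin.val_rev i
    have h4 := Fin.val_rev j
    have h5 : (i : ℕ) ≤ j := hij
    change d j - j.rev ≤ d i - i.rev
    omega
  -- The list of row lengths may end in zeros, so the diagram has at most `N` rows.
  refine ⟨YoungDiagram.ofRowLens _ hsorted, ?_, ?_⟩
  · by_contra hlt
    have := YoungDiagram.mem_iff_lt_colLen.mpr (not_le.mp hlt)
    rw [YoungDiagram.mem_ofRowLens] at this
    obtain ⟨h1, -⟩ := this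
    simp at h1
  · ext i
    have := YoungDiagram.rowLen_ofRowLens (hw := hsorted) ⟨i, by simp⟩
    rw [expo_apply]
    refine (congrArg (· + (i.rev : ℕ)) this).trans ?_
    have h1 := hge i
    have h2 := Fin.val_rev i
    simp
    omega

/-- A diagram with at most n cells fits into the n × n square. -/
theorem finite_card_le (n : ℕ) : {μ : YoungDiagram | μ.card ≤ n}.Finite := by
  refine Set.Finite.of_finite_image
    (((Finset.range n ×ˢ Finset.range n).powerset.finite_toSet).subset ?_)
    (f := YoungDiagram.cells) fun μ _ ν _ h => YoungDiagram.ext h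
  rintro _ ⟨μ, hμ, rfl⟩
  simp only [Finset.coe_powerset, Set.mem_preimage, Set.mem_powerset_iff, Finset.coe_subset]
  rintro ⟨i, j⟩ hij
  rw [YoungDiagram.mem_cells] at hij
  have h1 : i < μ.colLen 0 :=
    YoungDiagram.mem_iff_lt_colLen.mp (μ.up_left_mem le_rfl (Nat.zero_le j) hij)
  have h2 : j < μ.transpose.colLen 0 := by
    rw [YoungDiagram.colLen_transpose]
    exact YoungDiagram.mem_iff_lt_rowLen.mp (μ.up_left_mem (Nat.zero_le i) le_rfl hij)
  have h3 := colLen_le_card μ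
  have h4 := colLen_le_card μ.transpose
  have h5 : μ.transpose.card = μ.card := by
    simp [YoungDiagram.card, YoungDiagram.transpose]
  have : μ.card ≤ n := hμ
  simp only [Finset.mem_product, Finset.mem_range]
  omega

/-- The Young diagrams with at most `n` cells. -/
def diagramsLE (n : ℕ) : Finset YoungDiagram := (finite_card_le n).toFinset

@[simp]
theorem mem_diagramsLE {n : ℕ} {μ : YoungDiagram} : μ ∈ diagramsLE n ↔ μ.card ≤ n := by
  simp [diagramsLE]

end Exponents

/-! ### Expansion of antisymmetric series in alternants, and cancellation of a_δ. -/

section Expansion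

variable (R : Type*) [CommRing R] (N : ℕ)

/-- The alternant `a_{λ+δ}`. -/
def schurAlternant (μ : YoungDiagram) : MvPowerSeries (Fin N) R :=
  alternant fun j => PowerSeries.X ^ (expo N μ j)

/-- The Vandermonde alternant `a_δ`. -/
def vandermondeAlternant : MvPowerSeries (Fin N) R :=
  alternant fun j => PowerSeries.X ^ (j.rev : ℕ)

theorem schurAlternant_bot : schurAlternant R N ⊥ = vandermondeAlternant R N := by
  have : ∀ i, (⊥ : YoungDiagram).rowLen i = 0 := fun i =>
    rowLen_eq_zero _ _ ((colLen_le_card ⊥).trans (Nat.zero_le _))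
  simp [schurAlternant, vandermondeAlternant, this]

variable {R N}

theorem coeff_expo_schurAlternant {μ ν : YoungDiagram} (hμ : μ.colLen 0 ≤ N)
    (hν : ν.colLen 0 ≤ N) [Decidable (μ = ν)] :
    MvPowerSeries.coeff (expo N μ) (schurAlternant R N ν) = if μ = ν then 1 else 0 := by
  rw [schurAlternant, coeff_alternant]
  split_ifs with h
  · subst h
    rw [← Matrix.det_one (R := R) (n := Fin N)]
    congr 1
    ext i j
    rw [Matrix.of_apply, PowerSeries.coeff_X_pow, Matrix.one_apply]
    simp only [(strictAnti_expo N μ).injective.eq_iff]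
  -- Strictly decreasing sequences of equal length with nested ranges coincide. For μ ≠ ν some
  -- exponent of μ is therefore missing from ν, and the coefficient matrix has a zero row.
  · have hne : ¬ Set.range (expo N μ) ⊆ Set.range (expo N ν) := by
      intro hsub
      refine h (expo_injective N hμ hν (DFunLike.coe_injective ?_))
      refine ((strictAnti_expo N μ).range_inj (strictAnti_expo N ν)).mp ?_
      refine Set.eq_of_subset_of_ncard_le hsub ?_ (Set.finite_range _)
      rw [Set.ncard_eq_toFinset_card', Set.ncard_eq_toFinset_card']
      simp [Set.toFinset_range, Finset.card_image_of_injective,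
        (strictAnti_expo N μ).injective, (strictAnti_expo N ν).injective]
    rw [Set.not_subset] at hne
    obtain ⟨_, ⟨i, rfl⟩, hi⟩ := hne
    refine Matrix.det_eq_zero_of_row_eq_zero i fun j => ?_
    rw [Matrix.of_apply, PowerSeries.coeff_X_pow, if_neg fun hij => hi ⟨j, hij.symm⟩]

theorem coeff_schurAlternant_eq_zero (μ : YoungDiagram) (d : Fin N →₀ ℕ)
    (hd : d.degree ≠ (expo N μ).degree) :
    MvPowerSeries.coeff d (schurAlternant R N μ) = 0 := by
  rw [schurAlternant, coeff_alternant, Matrix.det_apply]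
  refine Finset.sum_eq_zero fun σ _ => ?_
  suffices h : ∃ i, d (σ i) ≠ expo N μ i by
    obtain ⟨i, hi⟩ := h
    rw [Finset.prod_eq_zero (Finset.mem_univ i), smul_zero]
    rw [Matrix.of_apply, PowerSeries.coeff_X_pow, if_neg hi]
  by_contra! hall
  refine hd ?_
  rw [Finsupp.degree_eq_sum, Finsupp.degree_eq_sum, ← Equiv.sum_comp σ]
  exact Finset.sum_congr rfl fun i _ => hall i

theorem map_schurAlternant {S : Type*} [CommRing S] (φ : R →+* S) (μ : YoungDiagram) :
    MvPowerSeries.map φ (schurAlternant R N μ) = schurAlternant S N μ := by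
  ext d
  rw [MvPowerSeries.coeff_map, schurAlternant, schurAlternant, coeff_alternant, coeff_alternant,
    RingHom.map_det]
  congr 1
  ext i j
  simp [PowerSeries.coeff_X_pow, apply_ite φ]

theorem vandermondeAlternant_eq_prod : vandermondeAlternant R N
    = ∏ i : Fin N, ∏ j ∈ Finset.Ioi i, (MvPowerSeries.X i - MvPowerSeries.X j) := by
  rw [vandermondeAlternant, alternant]
  have h1 : (Matrix.of fun i j : Fin N => (PowerSeries.X ^ (j.rev : ℕ) : PowerSeries R).subst
      (MvPowerSeries.X i : MvPowerSeries (Fin N) R))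
      = Matrix.projVandermonde 1 fun i => (MvPowerSeries.X i : MvPowerSeries (Fin N) R) := by
    ext1 i j
    rw [Matrix.of_apply, Matrix.projVandermonde_apply,
      PowerSeries.subst_pow (PowerSeries.HasSubst.X i), PowerSeries.subst_X
      (PowerSeries.HasSubst.X i)]
    simp
  rw [h1, Matrix.det_projVandermonde]
  simp

theorem coeff_expo_bot_vandermondeAlternant :
    MvPowerSeries.coeff (expo N ⊥) (vandermondeAlternant R N) = 1 := by
  classical
  have h0 : (⊥ : YoungDiagram).colLen 0 ≤ N := (colLen_le_card ⊥).trans (Nat.zero_le _)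
  rw [← schurAlternant_bot, coeff_expo_schurAlternant h0 h0, if_pos rfl]

theorem vandermondeAlternant_order_le [Nontrivial R] :
    (vandermondeAlternant R N).order ≤ (expo N ⊥).degree :=
  MvPowerSeries.order_le (by rw [coeff_expo_bot_vandermondeAlternant]; exact one_ne_zero)

/-- This cancels a_δ in identities known only up to a given degree: orders add over a domain, and
a_δ has order at most |δ|. -/
theorem coeff_eq_zero_of_vandermondeAlternant_mul [IsDomain R] (f : MvPowerSeries (Fin N) R)
    (n : ℕ) (hf : ∀ d : Fin N →₀ ℕ, d.degree ≤ n + (expo N ⊥).degree →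
      MvPowerSeries.coeff d (vandermondeAlternant R N * f) = 0)
    (d : Fin N →₀ ℕ) (hd : d.degree ≤ n) : MvPowerSeries.coeff d f = 0 := by
  by_contra hne
  have h1 : f.order ≤ n := (MvPowerSeries.order_le hne).trans (by exact_mod_cast hd)
  have h2 : ((n + (expo N ⊥).degree + 1 : ℕ) : ℕ∞) ≤ (vandermondeAlternant R N * f).order :=
    MvPowerSeries.nat_le_order fun e he => hf e (by omega)
  rw [MvPowerSeries.order_mul] at h2
  have h3 := h2.trans (add_le_add vandermondeAlternant_order_le h1)
  have h4 : n + (expo N ⊥).degree + 1 ≤ (expo N ⊥).degree + n := by exact_mod_cast h3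
  omega

/-- An antisymmetric power series is, up to a given degree, the combination of the alternants
`a_{λ+δ}` given by its coefficients at the strictly decreasing exponents. -/
theorem IsAntisymm.coeff_eq_sum [CharZero R] [NoZeroDivisors R] {f : MvPowerSeries (Fin N) R}
    (hf : IsAntisymm f) (n : ℕ) (hn : n ≤ N) (d : Fin N →₀ ℕ)
    (hd : d.degree ≤ n + (expo N ⊥).degree) :
    MvPowerSeries.coeff d f = ∑ μ ∈ diagramsLE n,
      MvPowerSeries.coeff (expo N μ) f * MvPowerSeries.coeff d (schurAlternant R N μ) := by
  classical
  have hcol : ∀ μ ∈ diagramsLE n, μ.colLen 0 ≤ N := fun μ hμ =>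
    (colLen_le_card μ).trans ((mem_diagramsLE.mp hμ).trans hn)
  have hanti : IsAntisymm (f - ∑ μ ∈ diagramsLE n,
      MvPowerSeries.coeff (expo N μ) f • schurAlternant R N μ) :=
    hf.sub (IsAntisymm.sum _ fun μ _ => (isAntisymm_alternant _).smul _)
  have key := hanti.coeff_eq_zero_of_strictAnti (n + (expo N ⊥).degree) (fun e he hdeg => by
    obtain ⟨ν, hν, rfl⟩ := exists_expo_eq e he
    have hν' : ν ∈ diagramsLE n := by
      rw [degree_expo N ν hν] at hdeg
      rw [mem_diagramsLE]
      omega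
    rw [map_sub, map_sum, Finset.sum_eq_single ν, MvPowerSeries.coeff_smul,
      coeff_expo_schurAlternant hν hν, if_pos rfl, mul_one, sub_self]
    · intro μ hμ hne
      rw [MvPowerSeries.coeff_smul, coeff_expo_schurAlternant hν (hcol μ hμ), if_neg hne.symm,
        mul_zero]
    · exact fun h => absurd hν' h) d hd
  rw [map_sub, sub_eq_zero, map_sum] at key
  rw [key]
  exact Finset.sum_congr rfl fun μ _ => MvPowerSeries.coeff_smul _ _ _

end Expansion

/-! ### Jacobi-Trudi and symplectic determinants of a power series. -/

section Determinants

variable {R : Type*} [CommRing R]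

/-- From row `l` on the matrix is upper unitriangular, so expansion along the last row removes one
row at a time. This lets determinants of size ℓ(λ) be computed in any larger size `N`. -/
theorem det_stable (e : ℕ → ℕ → R) (l N : ℕ) (hl : l ≤ N)
    (hlow : ∀ i j, l ≤ i → j < i → e i j = 0) (hdiag : ∀ i, l ≤ i → e i i = 1) :
    Matrix.det (Matrix.of fun i j : Fin N => e i j)
      = Matrix.det (Matrix.of fun i j : Fin l => e i j) := by
  induction N, hl using Nat.le_induction with
  | base => rfl
  | succ N hN ih =>
    rw [Matrix.det_succ_row _ (Fin.last N), Fin.sum_univ_castSucc, Finset.sum_eq_zero, zero_add,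
      ← ih]
    · simp only [Matrix.of_apply, Fin.val_last, hdiag N hN, Fin.succAbove_last, mul_one,
        Even.neg_one_pow (Even.add_self N), one_mul]
      rfl
    · intro j _
      rw [Matrix.of_apply, hlow _ _ (by simpa using hN) (by simp), mul_zero, zero_mul]

/-- The coefficient of a power series at an integer exponent. -/
def coeffInt (H : PowerSeries R) (k : ℤ) : R := if 0 ≤ k then PowerSeries.coeff k.toNat H else 0

theorem coeffInt_of_neg (H : PowerSeries R) {k : ℤ} (hk : k < 0) : coeffInt H k = 0 :=
  if_neg (not_le.mpr hk)

theorem coeffInt_zero (H : PowerSeries R) : coeffInt H 0 = PowerSeries.constantCoeff H := by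
  simp [coeffInt]

theorem coeff_X_pow_mul_eq_coeffInt (H : PowerSeries R) (a b : ℕ) :
    PowerSeries.coeff a (PowerSeries.X ^ b * H) = coeffInt H (a - b) := by
  rw [PowerSeries.coeff_X_pow_mul', coeffInt]
  split_ifs with h1 h2 h2
  · congr 2
    omega
  · omega
  · omega
  · rfl

theorem map_coeffInt {S : Type*} [CommRing S] (φ : R →+* S) (H : PowerSeries R) (k : ℤ) :
    φ (coeffInt H k) = coeffInt (PowerSeries.map φ H) k := by
  rw [coeffInt, coeffInt, apply_ite φ, map_zero, PowerSeries.coeff_map]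

/-- The Jacobi-Trudi determinant of size `N` in the coefficients of `H`. -/
def jacobiTrudi (H : PowerSeries R) (N : ℕ) (μ : YoungDiagram) : R :=
  Matrix.det (Matrix.of fun i j : Fin N => coeffInt H ((μ.rowLen i : ℤ) - (i : ℤ) + (j : ℤ)))

/-- The symplectic determinant of size `N` in the coefficients of `H`. -/
def symplecticDet (H : PowerSeries R) (N : ℕ) (μ : YoungDiagram) : R :=
  Matrix.det (Matrix.of fun i j : Fin N =>
    if (j : ℕ) = 0 then coeffInt H ((μ.rowLen i : ℤ) - (i : ℤ))
    else coeffInt H ((μ.rowLen i : ℤ) - (i : ℤ) + (j : ℤ))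
      + coeffInt H ((μ.rowLen i : ℤ) - (i : ℤ) - (j : ℤ)))

theorem jacobiTrudi_stable (H : PowerSeries R) (hH : PowerSeries.constantCoeff H = 1) (N : ℕ)
    (μ : YoungDiagram) (hμ : μ.colLen 0 ≤ N) :
    jacobiTrudi H N μ = jacobiTrudi H (μ.colLen 0) μ := by
  refine det_stable (fun i j => coeffInt H ((μ.rowLen i : ℤ) - (i : ℤ) + (j : ℤ))) _ _ hμ
    (fun i j hi hj => ?_) (fun i hi => ?_)
  · rw [rowLen_eq_zero μ i hi, coeffInt_of_neg]
    omega
  · simp [rowLen_eq_zero μ i hi, coeffInt_zero, hH]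

theorem symplecticDet_stable (H : PowerSeries R) (hH : PowerSeries.constantCoeff H = 1) (N : ℕ)
    (μ : YoungDiagram) (hμ : μ.colLen 0 ≤ N) :
    symplecticDet H N μ = symplecticDet H (μ.colLen 0) μ := by
  refine det_stable (fun i j => if j = 0 then coeffInt H ((μ.rowLen i : ℤ) - (i : ℤ))
    else coeffInt H ((μ.rowLen i : ℤ) - (i : ℤ) + (j : ℤ))
      + coeffInt H ((μ.rowLen i : ℤ) - (i : ℤ) - (j : ℤ))) _ _ hμ
    (fun i j hi hj => ?_) (fun i hi => ?_)
  · rw [rowLen_eq_zero μ i hi]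
    split_ifs
    · rw [coeffInt_of_neg]
      omega
    · rw [coeffInt_of_neg, coeffInt_of_neg, add_zero] <;> omega
  · rw [rowLen_eq_zero μ i hi]
    split_ifs with h0
    · simp [h0, coeffInt_zero, hH]
    · rw [coeffInt_of_neg H (k := ((0 : ℕ) : ℤ) - i - i) (by omega)]
      simp [coeffInt_zero, hH]

theorem jacobiTrudi_bot (H : PowerSeries R) (hH : PowerSeries.constantCoeff H = 1) (N : ℕ) :
    jacobiTrudi H N ⊥ = 1 := by
  have h0 : (⊥ : YoungDiagram).colLen 0 = 0 := Nat.le_zero.mp (colLen_le_card ⊥)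
  rw [jacobiTrudi_stable H hH N ⊥ (h0.le.trans (Nat.zero_le N)), h0]
  simp [jacobiTrudi]

theorem map_jacobiTrudi {S : Type*} [CommRing S] (φ : R →+* S) (H : PowerSeries R) (N : ℕ)
    (μ : YoungDiagram) : φ (jacobiTrudi H N μ) = jacobiTrudi (PowerSeries.map φ H) N μ := by
  rw [jacobiTrudi, jacobiTrudi, RingHom.map_det]
  congr 1
  ext i j
  exact map_coeffInt φ H _

/-- Coefficient form of the Cauchy identity: the index is (λ_i + N - 1 - i) - (N - 1 - j) = λ_i - i
+ j. -/
theorem coeff_expo_alternant_X_pow_mul (H : PowerSeries R) (N : ℕ) (μ : YoungDiagram) :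
    MvPowerSeries.coeff (expo N μ)
      (alternant fun j : Fin N => PowerSeries.X ^ (j.rev : ℕ) * H) = jacobiTrudi H N μ := by
  rw [coeff_alternant, jacobiTrudi]
  congr 1
  ext i j
  rw [Matrix.of_apply, Matrix.of_apply, coeff_X_pow_mul_eq_coeffInt]
  congr 1
  rw [expo_apply, Fin.val_rev, Fin.val_rev]
  omega

end Determinants

/-! ### The denominator identity for the symplectic family. -/

section TypeC

variable {R : Type*} [CommRing R]

/-- The functions `u_j` with `y ^ (1 - N) * u_j(y) = y ^ j + y ^ (-j)` for `j ≥ 1`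
and `y ^ (1 - N) * u_0(y) = 1`. -/
def symplecticFamily (R : Type*) [CommRing R] (N : ℕ) (j : Fin N) : PowerSeries R :=
  if (j : ℕ) = 0 then PowerSeries.X ^ (j.rev : ℕ)
  else PowerSeries.X ^ (j.rev : ℕ) + PowerSeries.X ^ (j.rev + 2 * j : ℕ)

/-- The two powers in column j ≥ 1 shift the index λ_i - i by +j and -j, as in the definition of
sp_λ. -/
theorem coeff_expo_alternant_symplecticFamily_mul (H : PowerSeries R) (N : ℕ)
    (μ : YoungDiagram) :
    MvPowerSeries.coeff (expo N μ) (alternant fun j : Fin N => symplecticFamily R N j * H)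
      = symplecticDet H N μ := by
  rw [coeff_alternant, symplecticDet]
  congr 1
  ext i j
  have hi := Fin.val_rev i
  have hj := Fin.val_rev j
  rw [Matrix.of_apply, Matrix.of_apply, symplecticFamily]
  split_ifs with h0
  · rw [coeff_X_pow_mul_eq_coeffInt]
    congr 1
    rw [expo_apply]
    omega
  · rw [add_mul, map_add, coeff_X_pow_mul_eq_coeffInt, coeff_X_pow_mul_eq_coeffInt]
    congr 2
    · rw [expo_apply]
      omega
    · rw [expo_apply]
      omega

/-- The coefficients of the polynomials `T_j` with `T_j(y + y⁻¹) = y ^ j + y ^ (-j)`. -/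
def lucasCoeff : ℕ → ℕ → ℤ
  | 0, k => if k = 0 then 2 else 0
  | 1, k => if k = 1 then 1 else 0
  | j + 2, 0 => -lucasCoeff j 0
  | j + 2, k + 1 => lucasCoeff (j + 1) k - lucasCoeff j (k + 1)

theorem lucasCoeff_eq_zero (j k : ℕ) (hjk : j < k) : lucasCoeff j k = 0 := by
  induction j using Nat.twoStepInduction generalizing k with
  | zero => simp [lucasCoeff]; omega
  | one => simp [lucasCoeff]; omega
  | more j h1 h2 =>
    obtain ⟨k, rfl⟩ := Nat.exists_eq_succ_of_ne_zero (show k ≠ 0 by omega)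
    rw [lucasCoeff, h2 k (by omega), h1 _ (by omega), sub_zero]

theorem lucasCoeff_self (j : ℕ) : lucasCoeff (j + 1) (j + 1) = 1 := by
  induction j with
  | zero => simp [lucasCoeff]
  | succ j ih => rw [lucasCoeff, ih, lucasCoeff_eq_zero _ _ (by omega), sub_zero]

/-- This is T_j(y + y⁻¹) = y^j + y^(-j) multiplied by y^(j+r). The range goes past k = j, where the
coefficients vanish, so that r = N - 1 - j gives a sum over all N columns. -/
theorem sum_lucasCoeff (y : R) (j r : ℕ) :
    ∑ k ∈ Finset.range (j + r + 1), (lucasCoeff j k : R) * (y ^ (j + r - k) * (1 + y ^ 2) ^ k)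
      = y ^ r + y ^ (2 * j + r) := by
  induction j using Nat.twoStepInduction generalizing r with
  | zero =>
    rw [Finset.sum_range_succ']
    simp [lucasCoeff, two_mul]
  | one =>
    rw [Finset.sum_range_succ', Finset.sum_eq_single 0]
    · simp [lucasCoeff]
      ring
    · intro b _ hb
      simp [lucasCoeff, hb]
    · simp
  | more j h1 h2 =>
    have e1 := h2 r
    -- In T_{j+2} = (y + y⁻¹) T_{j+1} - T_j the common multiplier is y^(j+2+r), which for T_j means
    -- r + 2.
    have e2 := h1 (r + 2)
    rw [Finset.sum_range_succ'] at e2 ⊢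
    have hsplit : ∑ k ∈ Finset.range (j + 2 + r),
        (lucasCoeff (j + 2) (k + 1) : R) * (y ^ (j + 2 + r - (k + 1)) * (1 + y ^ 2) ^ (k + 1))
        = (1 + y ^ 2) * ∑ k ∈ Finset.range (j + 1 + r + 1),
            (lucasCoeff (j + 1) k : R) * (y ^ (j + 1 + r - k) * (1 + y ^ 2) ^ k)
          - ∑ k ∈ Finset.range (j + (r + 2)), (lucasCoeff j (k + 1) : R) *
            (y ^ (j + (r + 2) - (k + 1)) * (1 + y ^ 2) ^ (k + 1)) := by
      rw [show j + 1 + r + 1 = j + 2 + r by ring, show j + (r + 2) = j + 2 + r by ring,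
        Finset.mul_sum, ← Finset.sum_sub_distrib]
      refine Finset.sum_congr rfl fun k _ => ?_
      rw [lucasCoeff, show j + 1 + r - k = j + 2 + r - (k + 1) by omega]
      push_cast
      ring
    rw [hsplit, e1]
    have h0 : (lucasCoeff (j + 2) 0 : R) = -(lucasCoeff j 0 : R) := by
      rw [lucasCoeff]
      push_cast
      rfl
    rw [h0, show j + 2 + r - 0 = j + (r + 2) - 0 by omega]
    linear_combination -e2

/-- The family is a unitriangular combination of the columns y^(N-1-k) (1 + y²)^k, which form a
homogeneous Vandermonde matrix. Its factors are (1 + y_j²) y_i - (1 + y_i²) y_j = (y_i - y_j)(1 -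
y_i y_j). -/
theorem alternant_symplecticFamily (N : ℕ) : alternant (symplecticFamily R N)
    = (∏ i : Fin N, ∏ j ∈ Finset.Ioi i,
        (1 - MvPowerSeries.X i * MvPowerSeries.X j : MvPowerSeries (Fin N) R))
      * vandermondeAlternant R N := by
  let y : Fin N → MvPowerSeries (Fin N) R := fun i => MvPowerSeries.X i
  -- Column 0 is set apart because T_0 = 2, while the family has 1 there; this also keeps the
  -- diagonal equal to 1.
  let C : Matrix (Fin N) (Fin N) (MvPowerSeries (Fin N) R) := Matrix.of fun k j =>
    if (j : ℕ) = 0 then (if (k : ℕ) = 0 then 1 else 0) else (lucasCoeff j k : ℤ)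
  have hC : C.det = 1 := by
    rw [Matrix.det_of_isUpperTriangular]
    · refine Finset.prod_eq_one fun j _ => ?_
      simp only [C, Matrix.of_apply]
      split_ifs with h0
      · rfl
      · obtain ⟨j', hj'⟩ := Nat.exists_eq_succ_of_ne_zero h0
        rw [hj', Nat.succ_eq_add_one, lucasCoeff_self, Int.cast_one]
    · intro k j hjk
      have hjk' : (j : ℕ) < k := hjk
      simp only [C, Matrix.of_apply]
      rw [lucasCoeff_eq_zero _ _ hjk', Int.cast_zero]
      split_ifs <;> first | rfl | omega
  have hmul : (Matrix.of fun i j => (symplecticFamily R N j).subst (y i))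
      = Matrix.projVandermonde (fun i => 1 + y i ^ 2) y * C := by
    ext1 i j
    have hs : PowerSeries.HasSubst (y i) := PowerSeries.HasSubst.X i
    rw [Matrix.of_apply, Matrix.mul_apply, symplecticFamily]
    simp only [Matrix.projVandermonde_apply, C, Matrix.of_apply]
    split_ifs with h0
    · rw [Finset.sum_eq_single j]
      · rw [if_pos h0, h0, PowerSeries.subst_pow hs, PowerSeries.subst_X hs]
        simp
      · intro k _ hk
        rw [if_neg, mul_zero]
        exact fun hk' => hk (Fin.ext (hk'.trans h0.symm))
      · simp
    · rw [PowerSeries.subst_add hs, PowerSeries.subst_pow hs, PowerSeries.subst_pow hs,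
        PowerSeries.subst_X hs]
      have hj := Fin.val_rev j
      have key := sum_lucasCoeff (y i) j (j.rev : ℕ)
      rw [show (j : ℕ) + j.rev + 1 = N by omega, Finset.sum_range] at key
      rw [show (j.rev : ℕ) + 2 * j = 2 * j + j.rev by ring, ← key]
      refine Finset.sum_congr rfl fun k _ => ?_
      rw [show (j : ℕ) + j.rev - k = k.rev by rw [Fin.val_rev k]; omega]
      ring
  rw [alternant]
  change Matrix.det (Matrix.of fun i j => (symplecticFamily R N j).subst (y i)) = _
  rw [hmul, Matrix.det_mul, hC, mul_one, Matrix.det_projVandermonde, vandermondeAlternant_eq_prod,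
    ← Finset.prod_mul_distrib]
  refine Finset.prod_congr rfl fun i _ => ?_
  rw [← Finset.prod_mul_distrib]
  refine Finset.prod_congr rfl fun j _ => ?_
  simp only [y]
  ring

end TypeC

/-! ### The bialternant formula. -/

section Bialternant

theorem coeff_coe_mul_eq_sum {S : Type*} [CommRing S] (q : Polynomial S) (N : ℕ)
    (hq : q.natDegree < N) (H : PowerSeries S) (a : ℕ) :
    PowerSeries.coeff a ((q : PowerSeries S) * H)
      = ∑ k : Fin N, q.coeff k * coeffInt H (a - (k : ℕ)) := by
  have h1 : (q : PowerSeries S) = ∑ k ∈ Finset.range N,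
      PowerSeries.C (q.coeff k) * PowerSeries.X ^ k := by
    conv_lhs => rw [q.as_sum_range_C_mul_X_pow' hq]
    rw [← Polynomial.coeToPowerSeries.ringHom_apply, map_sum]
    refine Finset.sum_congr rfl fun k _ => ?_
    simp
  rw [h1, Finset.sum_mul, map_sum, Finset.sum_range]
  refine Finset.sum_congr rfl fun k _ => ?_
  rw [mul_assoc, PowerSeries.coeff_C_mul, coeff_X_pow_mul_eq_coeffInt]

theorem mk_pow_mul_one_sub {S : Type*} [CommRing S] (x : S) :
    PowerSeries.mk (fun n => x ^ n) * (1 - PowerSeries.C x * PowerSeries.X) = 1 := by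
  have := congrArg (PowerSeries.rescale x) (PowerSeries.mk_one_mul_one_sub_eq_one S)
  rw [map_mul, map_sub, map_one, PowerSeries.rescale_X] at this
  have h1 : PowerSeries.rescale x (PowerSeries.mk 1) = PowerSeries.mk fun n => x ^ n := by
    ext n
    simp [PowerSeries.coeff_rescale]
  rwa [h1] at this

/-- The bialternant formula for Jacobi-Trudi determinants. -/
theorem jacobiTrudi_mul_det {S : Type*} [CommRing S] {N : ℕ} (x : Fin N → S) (H : PowerSeries S)
    (hH : H * ∏ i, (1 - PowerSeries.C (x i) * PowerSeries.X) = 1) (μ : YoungDiagram) :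
    Matrix.det (Matrix.of fun i j : Fin N => x i ^ (expo N μ j))
      = jacobiTrudi H N μ * Matrix.det (Matrix.of fun i j : Fin N => x i ^ (j.rev : ℕ)) := by
  classical
  -- Omitting the j-th factor gives E_j H = 1 / (1 - x_j t), whose coefficients are the powers of
  -- x_j.
  let E : Fin N → Polynomial S := fun j =>
    ∏ i ∈ Finset.univ.erase j, (1 - Polynomial.C (x i) * Polynomial.X)
  have hdeg : ∀ j, (E j).natDegree < N := by
    intro j
    have hN : 0 < N := Fin.pos j
    refine lt_of_le_of_lt (Polynomial.natDegree_prod_le _ _) ?_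
    refine lt_of_le_of_lt (Finset.sum_le_card_nsmul _ _ 1 fun i _ => ?_) ?_
    · compute_degree
    · simp [hN]
  have hE : ∀ j, (E j : PowerSeries S) * H = PowerSeries.mk (fun n => x j ^ n) := by
    intro j
    have h1 : (E j : PowerSeries S)
        = ∏ i ∈ Finset.univ.erase j, (1 - PowerSeries.C (x i) * PowerSeries.X) := by
      rw [← Polynomial.coeToPowerSeries.ringHom_apply, map_prod]
      simp
    have h2 := mk_pow_mul_one_sub (x j)
    rw [← Finset.mul_prod_erase _ _ (Finset.mem_univ j), ← h1] at hH
    linear_combination (-(E j : PowerSeries S) * H) * h2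
      + PowerSeries.mk (fun n => x j ^ n) * hH
  let M : Matrix (Fin N) (Fin N) S := Matrix.of fun k j => (E j).coeff (k.rev : ℕ)
  have key : ∀ ν : YoungDiagram, Matrix.det (Matrix.of fun i j : Fin N => x i ^ (expo N ν j))
      = jacobiTrudi H N ν * M.det := by
    intro ν
    rw [jacobiTrudi, ← Matrix.det_mul, ← Matrix.det_transpose]
    congr 1
    ext i j
    rw [Matrix.transpose_apply, Matrix.of_apply, Matrix.mul_apply]
    have h3 := congrArg (PowerSeries.coeff (expo N ν i)) (hE j)
    rw [PowerSeries.coeff_mk, coeff_coe_mul_eq_sum _ N (hdeg j)] at h3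
    rw [← h3, ← Equiv.sum_comp Fin.revPerm]
    refine Finset.sum_congr rfl fun k _ => ?_
    rw [Matrix.of_apply, mul_comm, Fin.revPerm_apply]
    change _ = _ * (E j).coeff (k.rev : ℕ)
    congr 2
    rw [expo_apply, Fin.val_rev, Fin.val_rev]
    omega
  have hc : PowerSeries.constantCoeff H = 1 := by
    have := congrArg PowerSeries.constantCoeff hH
    simpa using this
  -- The factor `M.det` does not depend on the partition; the empty partition identifies it with the
  -- Vandermonde determinant.
  have h0 := key ⊥
  rw [jacobiTrudi_bot H hc, one_mul] at h0
  rw [key, ← h0]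
  congr 2
  ext i j
  have : ∀ i, (⊥ : YoungDiagram).rowLen i = 0 := fun i =>
    rowLen_eq_zero _ _ ((colLen_le_card ⊥).trans (Nat.zero_le _))
  simp [this]

end Bialternant

/-! ### Restriction to finitely many variables. -/

section Truncation

variable (K : Type*) [Field K]

/-- The generating series of the complete homogeneous symmetric functions. -/
def hSeries : PowerSeries (Lambda K) := PowerSeries.mk (h K)

theorem coeff_coe_h (n : ℕ) (d : ℕ →₀ ℕ) :
    MvPowerSeries.coeff d (h K n : MvPowerSeries ℕ K) = if d.degree = n then 1 else 0 := rfl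

theorem h_zero : h K 0 = 1 := by
  classical
  refine Subtype.ext (MvPowerSeries.ext fun d => ?_)
  rw [coeff_coe_h, OneMemClass.coe_one, MvPowerSeries.coeff_one]
  simp only [Finsupp.degree_eq_zero_iff]

theorem constantCoeff_hSeries : PowerSeries.constantCoeff (hSeries K) = 1 := by
  rw [← PowerSeries.coeff_zero_eq_constantCoeff_apply, hSeries, PowerSeries.coeff_mk, h_zero]

theorem hInt_eq_coeffInt (k : ℤ) : hInt K k = coeffInt (hSeries K) k := by
  simp [hInt, coeffInt, hSeries]

theorem schur_eq_jacobiTrudi (N : ℕ) (μ : YoungDiagram) (hμ : μ.colLen 0 ≤ N) :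
    schur K μ = jacobiTrudi (hSeries K) N μ := by
  rw [jacobiTrudi_stable _ (constantCoeff_hSeries K) N μ hμ, schur, jacobiTrudi]
  simp only [hInt_eq_coeffInt]

theorem sp_eq_symplecticDet (N : ℕ) (μ : YoungDiagram) (hμ : μ.colLen 0 ≤ N) :
    sp K μ = symplecticDet (hSeries K) N μ := by
  rw [symplecticDet_stable _ (constantCoeff_hSeries K) N μ hμ, sp, symplecticDet]
  simp only [hInt_eq_coeffInt]

/-- Setting all variables except the first `N` to zero. -/
def truncVars (N : ℕ) : MvPowerSeries ℕ K →ₐ[K] MvPowerSeries (Fin N) K :=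
  MvPowerSeries.killCompl Fin.valEmbedding

variable {K}

theorem coeff_truncVars (N : ℕ) (f : MvPowerSeries ℕ K) (e : Fin N →₀ ℕ) :
    MvPowerSeries.coeff e (truncVars K N f)
      = MvPowerSeries.coeff (Finsupp.embDomain Fin.valEmbedding e) f :=
  MvPowerSeries.coeff_killCompl f e

theorem degree_embDomain {α β : Type*} (f : α ↪ β) (e : α →₀ ℕ) :
    (Finsupp.embDomain f e).degree = e.degree := by
  rw [Finsupp.embDomain_eq_mapDomain, Finsupp.degree_mapDomain]

theorem truncVars_h (N n : ℕ) : truncVars K N (h K n)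
    = PowerSeries.coeff n (∏ i : Fin N,
      PowerSeries.mk fun k => (MvPowerSeries.X i : MvPowerSeries (Fin N) K) ^ k) := by
  classical
  ext e
  rw [coeff_truncVars, coeff_coe_h, degree_embDomain, PowerSeries.coeff_prod, map_sum]
  have h1 : ∀ l : Fin N →₀ ℕ, MvPowerSeries.coeff e (∏ i, PowerSeries.coeff (l i)
      (PowerSeries.mk fun k => (MvPowerSeries.X i : MvPowerSeries (Fin N) K) ^ k))
      = if e = l then 1 else 0 := by
    intro l
    rw [← MvPowerSeries.coeff_monomial, MvPowerSeries.monomial_eq', map_one, one_mul,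
      Finsupp.prod_fintype _ _ (fun i => pow_zero _)]
    simp
  simp only [h1, Finset.sum_ite_eq, Finset.mem_finsuppAntidiag]
  simp [Finsupp.degree_eq_sum]

variable (K) in
/-- The series of complete homogeneous symmetric polynomials in `N` variables. -/
def hSeriesTrunc (N : ℕ) : PowerSeries (MvPowerSeries (Fin N) K) :=
  PowerSeries.map ((truncVars K N).comp (Lambda K).val).toRingHom (hSeries K)

theorem hSeriesTrunc_mul_prod (N : ℕ) : hSeriesTrunc K N
    * ∏ i, (1 - PowerSeries.C (MvPowerSeries.X i : MvPowerSeries (Fin N) K) * PowerSeries.X)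
      = 1 := by
  have h1 : hSeriesTrunc K N = ∏ i : Fin N,
      PowerSeries.mk fun k => (MvPowerSeries.X i : MvPowerSeries (Fin N) K) ^ k := by
    ext1 n
    rw [← truncVars_h, hSeriesTrunc, PowerSeries.coeff_map, hSeries, PowerSeries.coeff_mk]
    rfl
  rw [h1, ← Finset.prod_mul_distrib]
  exact Finset.prod_eq_one fun i _ => mk_pow_mul_one_sub _

theorem vandermondeAlternant_mul_truncVars_schur (N : ℕ) (μ : YoungDiagram)
    (hμ : μ.colLen 0 ≤ N) :
    vandermondeAlternant K N * truncVars K N (schur K μ) = schurAlternant K N μ := by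
  have h1 : truncVars K N (schur K μ) = jacobiTrudi (hSeriesTrunc K N) N μ := by
    rw [schur_eq_jacobiTrudi K N μ hμ, hSeriesTrunc, ← map_jacobiTrudi]
    rfl
  have h2 := jacobiTrudi_mul_det (fun i => (MvPowerSeries.X i : MvPowerSeries (Fin N) K)) _
    (hSeriesTrunc_mul_prod N) μ
  have hs : ∀ (i : Fin N) (k : ℕ), (PowerSeries.X ^ k : PowerSeries K).subst
      (MvPowerSeries.X i : MvPowerSeries (Fin N) K) = MvPowerSeries.X i ^ k := by
    intro i k
    rw [PowerSeries.subst_pow (PowerSeries.HasSubst.X i),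
      PowerSeries.subst_X (PowerSeries.HasSubst.X i)]
  rw [h1, vandermondeAlternant, schurAlternant, alternant, alternant]
  simp only [hs]
  rw [h2, mul_comm]

end Truncation

/-! ### Homogeneity of Schur functions. -/

section Homogeneity

variable {K : Type*} [Field K]

/-- The degrees are integers because single indices λ_i - i + j can be negative; in each term of the
determinant the shifts cancel and leave |λ|. -/
theorem degree_eq_of_coeff_prod_ne_zero {σ ι : Type*} (s : Finset ι)
    (f : ι → MvPowerSeries σ K) (k : ι → ℤ)
    (hf : ∀ i ∈ s, ∀ d, MvPowerSeries.coeff d (f i) ≠ 0 → (d.degree : ℤ) = k i) (d : σ →₀ ℕ)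
    (hd : MvPowerSeries.coeff d (∏ i ∈ s, f i) ≠ 0) : (d.degree : ℤ) = ∑ i ∈ s, k i := by
  classical
  rw [MvPowerSeries.coeff_prod] at hd
  obtain ⟨l, hl, hne⟩ := Finset.exists_ne_zero_of_sum_ne_zero hd
  rw [Finset.mem_finsuppAntidiag] at hl
  rw [← hl.1, map_sum, Nat.cast_sum]
  exact Finset.sum_congr rfl fun i hi => hf i hi _ (Finset.prod_ne_zero_iff.mp hne i hi)

theorem degree_eq_of_coeff_hInt_ne_zero (k : ℤ) (d : ℕ →₀ ℕ)
    (hd : MvPowerSeries.coeff d (hInt K k : MvPowerSeries ℕ K) ≠ 0) : (d.degree : ℤ) = k := by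
  rw [hInt] at hd
  split_ifs at hd with hk
  · rw [coeff_coe_h] at hd
    have : d.degree = k.toNat := by
      by_contra hne
      exact hd (if_neg hne)
    omega
  · simp at hd

theorem coeff_schur_eq_zero (μ : YoungDiagram) (d : ℕ →₀ ℕ) (hd : d.degree ≠ μ.card) :
    MvPowerSeries.coeff d (schur K μ : MvPowerSeries ℕ K) = 0 := by
  have h1 : (schur K μ : MvPowerSeries ℕ K) = Matrix.det (Matrix.of
      fun i j : Fin (μ.colLen 0) =>
        (hInt K ((μ.rowLen i : ℤ) - (i : ℤ) + (j : ℤ)) : MvPowerSeries ℕ K)) :=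
    RingHom.map_det (Lambda K).val.toRingHom _
  rw [h1, Matrix.det_apply, map_sum]
  simp only [Matrix.of_apply]
  refine Finset.sum_eq_zero fun σ _ => ?_
  rw [Units.smul_def, map_zsmul]
  by_contra hne
  have h2 := degree_eq_of_coeff_prod_ne_zero Finset.univ _
    (fun i => (μ.rowLen (σ i) : ℤ) - (σ i : ℕ) + (i : ℕ))
    (fun i _ e he => degree_eq_of_coeff_hInt_ne_zero _ e he) d
    (fun h0 => hne (by rw [h0, smul_zero]))
  rw [Finset.sum_add_distrib, Finset.sum_sub_distrib,
    Equiv.sum_comp σ (fun i => ((i : ℕ) : ℤ)), sub_add_cancel,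
    Equiv.sum_comp σ (fun i : Fin (μ.colLen 0) => (μ.rowLen i : ℤ)), ← Nat.cast_sum,
    sum_rowLen _ _ le_rfl] at h2
  exact hd (by exact_mod_cast h2)

end Homogeneity

/-! ### Schur coefficients read off in N variables. -/

section SchurCoeff

variable {K : Type*} [Field K]

/-- The coefficient of the Schur function `s_μ`, computed in `N` variables. -/
def schurCoeff (N : ℕ) (μ : YoungDiagram) : MvPowerSeries ℕ K →ₗ[K] K :=
  MvPowerSeries.coeff (expo N μ) ∘ₗ
    LinearMap.mulLeft K (vandermondeAlternant K N) ∘ₗ (truncVars K N).toLinearMap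

theorem schurCoeff_apply (N : ℕ) (μ : YoungDiagram) (f : MvPowerSeries ℕ K) :
    schurCoeff N μ f
      = MvPowerSeries.coeff (expo N μ) (vandermondeAlternant K N * truncVars K N f) := rfl

/-- Since a_δ is homogeneous and |μ+δ| = |μ| + |δ|, only the component of degree |μ| matters. -/
theorem schurCoeff_congr (N : ℕ) (μ : YoungDiagram) (hμ : μ.colLen 0 ≤ N)
    {f g : MvPowerSeries ℕ K}
    (hfg : ∀ d : ℕ →₀ ℕ, d.degree = μ.card → MvPowerSeries.coeff d f = MvPowerSeries.coeff d g) :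
    schurCoeff N μ f = schurCoeff N μ g := by
  classical
  rw [schurCoeff_apply, schurCoeff_apply, MvPowerSeries.coeff_mul, MvPowerSeries.coeff_mul]
  refine Finset.sum_congr rfl fun e he => ?_
  rw [Finset.HasAntidiagonal.mem_antidiagonal] at he
  by_cases h1 : e.1.degree = (expo N ⊥).degree
  · rw [coeff_truncVars, coeff_truncVars, hfg]
    rw [degree_embDomain]
    have h2 := degree_expo N μ hμ
    rw [← he, map_add, h1] at h2
    omega
  · rw [← schurAlternant_bot, coeff_schurAlternant_eq_zero _ _ h1, zero_mul, zero_mul]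

/-- No bound on ν is needed: if |ν| = |μ| the bialternant formula applies in N variables, and
otherwise homogeneity gives 0. -/
theorem schurCoeff_schur (N : ℕ) (μ ν : YoungDiagram) (hμ : μ.card ≤ N) [Decidable (μ = ν)] :
    schurCoeff N μ (schur K ν : MvPowerSeries ℕ K) = if μ = ν then 1 else 0 := by
  have hμ' := (colLen_le_card μ).trans hμ
  by_cases hcard : μ.card = ν.card
  · have hν' := (colLen_le_card ν).trans (hcard ▸ hμ)
    rw [schurCoeff_apply, vandermondeAlternant_mul_truncVars_schur N ν hν',
      coeff_expo_schurAlternant hμ' hν']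
  · rw [if_neg fun h => hcard (congrArg _ h), ← map_zero (schurCoeff (K := K) N μ)]
    refine schurCoeff_congr N μ hμ' fun d hd => ?_
    rw [coeff_schur_eq_zero ν d (hd ▸ hcard), map_zero]

/-- A permutation of the first N variables extends by the identity to all variables. -/
theorem rename_truncVars (N : ℕ) {f : MvPowerSeries ℕ K} (hf : f ∈ LambdaHat K)
    (σ : Equiv.Perm (Fin N)) :
    MvPowerSeries.rename σ (truncVars K N f) = truncVars K N f := by
  ext d
  have hde : ∀ i, (d.equivMapDomain σ.symm) i = d (σ i) := fun i => by simp
  rw [coeff_rename_perm σ _ d _ hde, coeff_truncVars, coeff_truncVars,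
    ← (mem_LambdaHat_iff f).mp hf (σ.viaEmbedding Fin.valEmbedding)]
  congr 2
  rw [Finsupp.embDomain_eq_mapDomain, Finsupp.embDomain_eq_mapDomain, ← Finsupp.mapDomain_comp,
    Finsupp.equivMapDomain_eq_mapDomain, ← Finsupp.mapDomain_comp]
  congr 1
  funext i
  simp only [Function.comp_apply]
  rw [Equiv.Perm.viaEmbedding_apply, Equiv.apply_symm_apply]

theorem exists_mapDomain_eq_embDomain (N : ℕ) (d : ℕ →₀ ℕ) (hd : d.degree ≤ N) :
    ∃ (σ : Equiv.Perm ℕ) (e : Fin N →₀ ℕ),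
      Finsupp.mapDomain σ d = Finsupp.embDomain Fin.valEmbedding e := by
  have hcard : d.support.card ≤ N := by
    refine le_trans ?_ hd
    rw [Finsupp.degree_apply, Finset.card_eq_sum_ones]
    exact Finset.sum_le_sum fun i hi => Nat.one_le_iff_ne_zero.mpr (Finsupp.mem_support_iff.mp hi)
  obtain ⟨g⟩ : Nonempty ((d.support : Set ℕ) ↪ Fin N) :=
    Function.Embedding.nonempty_of_card_le (by simpa using hcard)
  -- An injection of the finite support into the first N indices extends to a permutation of ℕ.
  obtain ⟨σ, hσ⟩ := Cardinal.extend_function_of_lt (g.trans Fin.valEmbedding)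
    ((Cardinal.lt_aleph0_of_finite _).trans_eq Cardinal.mk_nat.symm) ⟨Equiv.refl ℕ⟩
  refine ⟨σ, Finsupp.comapDomain Fin.valEmbedding (Finsupp.mapDomain σ d)
    Fin.valEmbedding.injective.injOn, ?_⟩
  rw [Finsupp.embDomain_comapDomain]
  intro k hk
  obtain ⟨i, hi, rfl⟩ := Finset.mem_image.mp (Finsupp.mapDomain_support hk)
  exact ⟨g ⟨i, hi⟩, (hσ ⟨i, hi⟩).symm⟩

theorem coeff_eq_zero_of_coeff_truncVars (N n : ℕ) (hn : n ≤ N) {f : MvPowerSeries ℕ K}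
    (hf : f ∈ LambdaHat K)
    (h0 : ∀ e : Fin N →₀ ℕ, e.degree ≤ n → MvPowerSeries.coeff e (truncVars K N f) = 0)
    (d : ℕ →₀ ℕ) (hd : d.degree ≤ n) : MvPowerSeries.coeff d f = 0 := by
  obtain ⟨σ, e, he⟩ := exists_mapDomain_eq_embDomain N d (hd.trans hn)
  rw [← (mem_LambdaHat_iff f).mp hf σ, he, ← coeff_truncVars]
  refine h0 e ?_
  rwa [← degree_embDomain Fin.valEmbedding, ← he, Finsupp.degree_mapDomain]

theorem coe_schur_mem (μ : YoungDiagram) : (schur K μ : MvPowerSeries ℕ K) ∈ LambdaHat K :=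
  (schur K μ).2.1

/-- The Schur expansion of an element of the completion. -/
theorem coeff_eq_sum_schurCoeff [CharZero K] {f : MvPowerSeries ℕ K} (hf : f ∈ LambdaHat K)
    (N n : ℕ) (hn : n ≤ N) (d : ℕ →₀ ℕ) (hd : d.degree ≤ n) :
    MvPowerSeries.coeff d f = ∑ μ ∈ diagramsLE n,
      schurCoeff N μ f * MvPowerSeries.coeff d (schur K μ : MvPowerSeries ℕ K) := by
  have key := coeff_eq_zero_of_coeff_truncVars N n hn
    (f := f - ∑ μ ∈ diagramsLE n, schurCoeff N μ f • (schur K μ : MvPowerSeries ℕ K))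
    (sub_mem hf (sum_mem fun μ _ => (LambdaHat K).smul_mem (coe_schur_mem μ) _))
    (coeff_eq_zero_of_vandermondeAlternant_mul _ n fun e he => ?_) d hd
  · rw [map_sub, sub_eq_zero, map_sum] at key
    rw [key]
    exact Finset.sum_congr rfl fun μ _ => MvPowerSeries.coeff_smul _ _ _
  · have hanti : IsAntisymm (vandermondeAlternant K N * truncVars K N f) :=
      (isAntisymm_alternant _).mul_symm (rename_truncVars N hf)
    rw [map_sub, mul_sub, map_sub, hanti.coeff_eq_sum n hn e he, sub_eq_zero, map_sum,
      Finset.mul_sum, map_sum]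
    refine Finset.sum_congr rfl fun μ hμ => ?_
    have hcol := (colLen_le_card μ).trans ((mem_diagramsLE.mp hμ).trans hn)
    rw [map_smul, mul_smul_comm, MvPowerSeries.coeff_smul,
      vandermondeAlternant_mul_truncVars_schur N μ hcol]
    rfl

end SchurCoeff

/-! ### The Schur basis and its pairing. -/

section Basis

variable (K : Type*) [Field K]

theorem linearIndependent_schur : LinearIndependent K (schur K) := by
  classical
  rw [linearIndependent_iff']
  intro s c hc μ hμ
  have h1 := congrArg (fun f : Lambda K => schurCoeff μ.card μ (f : MvPowerSeries ℕ K)) hc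
  simp only [AddSubmonoidClass.coe_finsetSum, SetLike.val_smul, map_sum, map_smul,
    schurCoeff_schur μ.card μ _ le_rfl, ZeroMemClass.coe_zero, map_zero] at h1
  simpa [hμ] using h1

variable [CharZero K]

theorem span_schur : ⊤ ≤ Submodule.span K (Set.range (schur K)) := by
  rintro f -
  obtain ⟨hf, n, hn⟩ := f.2
  have h1 : f = ∑ μ ∈ diagramsLE n, schurCoeff n μ (f : MvPowerSeries ℕ K) • schur K μ := by
    refine Subtype.ext (MvPowerSeries.ext fun d => ?_)
    rw [AddSubmonoidClass.coe_finsetSum, map_sum]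
    simp only [SetLike.val_smul, MvPowerSeries.coeff_smul]
    by_cases hd : d.degree ≤ n
    · exact coeff_eq_sum_schurCoeff hf n n le_rfl d hd
    · rw [hn d (by omega), Finset.sum_eq_zero]
      intro μ hμ
      rw [mem_diagramsLE] at hμ
      rw [coeff_schur_eq_zero μ d (by omega), mul_zero]
  rw [h1]
  exact sum_mem fun μ _ => Submodule.smul_mem _ _ (Submodule.subset_span ⟨μ, rfl⟩)

/-- The basis of Schur functions. -/
def schurBasis : Module.Basis YoungDiagram K (Lambda K) :=
  Module.Basis.mk (linearIndependent_schur K) (span_schur K)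

@[simp]
theorem schurBasis_apply (μ : YoungDiagram) : schurBasis K μ = schur K μ :=
  Module.Basis.mk_apply _ _ _

variable {K}

theorem schurBasis_coord (N : ℕ) (μ : YoungDiagram) (hμ : μ.card ≤ N) (f : Lambda K) :
    (schurBasis K).coord μ f = schurCoeff N μ (f : MvPowerSeries ℕ K) := by
  classical
  have : (schurBasis K).coord μ = schurCoeff N μ ∘ₗ (Lambda K).val.toLinearMap := by
    refine (schurBasis K).ext fun ν => ?_
    rw [Module.Basis.coord_apply, Module.Basis.repr_self, LinearMap.comp_apply,
      schurBasis_apply]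
    refine Eq.trans ?_ (schurCoeff_schur N μ ν hμ).symm
    rw [Finsupp.single_apply]
    simp only [eq_comm]
  rw [this]
  rfl

theorem pairing_schur (N : ℕ) (μ : YoungDiagram) (hμ : μ.card ≤ N) (g : LambdaHat K) :
    pairing (schurBasis K) (schur K μ) g = schurCoeff N μ (g : MvPowerSeries ℕ K) := by
  rw [← schurBasis_apply, pairing, Module.Basis.constr_basis, LinearMap.comp_apply,
    schurBasis_coord N μ hμ]
  refine schurCoeff_congr N μ ((colLen_le_card μ).trans hμ) fun d hd => ?_
  change MvPowerSeries.coeff d (MvPowerSeries.homogeneousComponent _ _) = _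
  rw [MvPowerSeries.coeff_homogeneousComponent, if_pos hd]

end Basis

/-! ### Existence and uniqueness of skewing operators. -/

section Skewing

variable (K : Type*) [Field K]

/-- The inclusion of the ring of symmetric functions in its completion. -/
def toHat : Lambda K →ₐ[K] LambdaHat K := Subalgebra.inclusion fun _ hf => hf.1

variable {K}

@[simp]
theorem coe_toHat (f : Lambda K) : (toHat K f : MvPowerSeries ℕ K) = f := rfl

theorem coeff_mul_eq_of_coeff_eq {R σ : Type*} [CommRing R] (k f g : MvPowerSeries σ R)
    (d : σ →₀ ℕ) (hfg : ∀ e : σ →₀ ℕ, e.degree ≤ d.degree →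
      MvPowerSeries.coeff e f = MvPowerSeries.coeff e g) :
    MvPowerSeries.coeff d (k * f) = MvPowerSeries.coeff d (k * g) := by
  classical
  rw [MvPowerSeries.coeff_mul, MvPowerSeries.coeff_mul]
  refine Finset.sum_congr rfl fun e he => ?_
  rw [Finset.HasAntidiagonal.mem_antidiagonal] at he
  rw [hfg]
  rw [← he, map_add]
  exact Nat.le_add_left _ _

variable [CharZero K]

/-- The operator adjoint to multiplication by an element of the completion. -/
def skewing (g : LambdaHat K) : Lambda K →ₗ[K] Lambda K :=
  (schurBasis K).constr K fun μ => ∑ ν ∈ diagramsLE μ.card,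
    pairing (schurBasis K) (schur K μ) (g * toHat K (schur K ν)) • schur K ν

theorem skewing_schur (g : LambdaHat K) (μ : YoungDiagram) :
    skewing g (schur K μ) = ∑ ν ∈ diagramsLE μ.card,
      pairing (schurBasis K) (schur K μ) (g * toHat K (schur K ν)) • schur K ν := by
  rw [skewing, ← schurBasis_apply, Module.Basis.constr_basis, schurBasis_apply]

theorem isSkewing_skewing (g : LambdaHat K) : IsSkewing (schurBasis K) g (skewing g) := by
  intro u v
  have key : (pairing (schurBasis K)).flip v ∘ₗ skewing g
      = (pairing (schurBasis K)).flip (g * v) := by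
    refine (schurBasis K).ext fun μ => ?_
    rw [schurBasis_apply, LinearMap.comp_apply, LinearMap.flip_apply, LinearMap.flip_apply,
      skewing_schur, map_sum, LinearMap.sum_apply]
    -- Pairing with s_μ sees only degree |μ|, so v may be replaced by its finite Schur expansion up
    -- to that degree.
    have h1 : pairing (schurBasis K) (schur K μ) (g * v) = pairing (schurBasis K) (schur K μ)
        (g * ∑ ν ∈ diagramsLE μ.card,
          pairing (schurBasis K) (schur K ν) v • toHat K (schur K ν)) := by
      rw [pairing_schur _ μ le_rfl, pairing_schur _ μ le_rfl]
      refine schurCoeff_congr _ μ (colLen_le_card μ) fun d hd => ?_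
      rw [MulMemClass.coe_mul, MulMemClass.coe_mul]
      refine coeff_mul_eq_of_coeff_eq _ _ _ d fun e he => ?_
      rw [coeff_eq_sum_schurCoeff v.2 μ.card μ.card le_rfl e (hd ▸ he),
        AddSubmonoidClass.coe_finsetSum, map_sum]
      refine Finset.sum_congr rfl fun ν hν => ?_
      rw [pairing_schur μ.card ν (mem_diagramsLE.mp hν), SetLike.val_smul,
        MvPowerSeries.coeff_smul, coe_toHat]
    rw [h1, Finset.mul_sum, map_sum]
    refine Finset.sum_congr rfl fun ν _ => ?_
    rw [map_smul, LinearMap.smul_apply, mul_smul_comm, map_smul, smul_eq_mul, smul_eq_mul,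
      mul_comm]
  exact LinearMap.congr_fun key u

theorem pairing_toHat_schur (μ : YoungDiagram) (u : Lambda K) :
    pairing (schurBasis K) u (toHat K (schur K μ)) = (schurBasis K).coord μ u := by
  classical
  have key : (pairing (schurBasis K)).flip (toHat K (schur K μ)) = (schurBasis K).coord μ := by
    refine (schurBasis K).ext fun ν => ?_
    rw [LinearMap.flip_apply, schurBasis_apply, pairing_schur _ ν le_rfl, coe_toHat,
      schurCoeff_schur _ ν μ le_rfl, Module.Basis.coord_apply, ← schurBasis_apply,
      Module.Basis.repr_self, Finsupp.single_apply]
  exact LinearMap.congr_fun key u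

/-- Testing against v = s_μ recovers every Schur coordinate of the image. -/
theorem IsSkewing.unique {g : LambdaHat K} {A B : Lambda K →ₗ[K] Lambda K}
    (hA : IsSkewing (schurBasis K) g A) (hB : IsSkewing (schurBasis K) g B) : B = A := by
  refine LinearMap.ext fun u => (schurBasis K).ext_elem fun μ => ?_
  rw [← Module.Basis.coord_apply, ← Module.Basis.coord_apply, ← pairing_toHat_schur μ,
    ← pairing_toHat_schur μ, hA, hB]

end Skewing

/-! ### κ_p in finitely many variables. -/

section Kappa

variable {K : Type*} [Field K]

theorem truncVars_X (N : ℕ) (i : Fin N) :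
    truncVars K N (MvPowerSeries.X (i : ℕ)) = MvPowerSeries.X i :=
  MvPowerSeries.killCompl_X (e := Fin.valEmbedding) i

theorem truncVars_subst_X (N : ℕ) (p : PowerSeries K) (i : Fin N) :
    truncVars K N (p.subst (MvPowerSeries.X (i : ℕ) : MvPowerSeries ℕ K))
      = p.subst (MvPowerSeries.X i : MvPowerSeries (Fin N) K) := by
  ext e
  have h1 : Finsupp.embDomain Fin.valEmbedding e (i : ℕ) = e i :=
    Finsupp.embDomain_apply_self Fin.valEmbedding e i
  have h2 : Finsupp.single (i : ℕ) (e i)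
      = Finsupp.embDomain Fin.valEmbedding (Finsupp.single i (e i)) :=
    (Finsupp.embDomain_single Fin.valEmbedding i (e i)).symm
  rw [coeff_truncVars, PowerSeries.coeff_subst_single, PowerSeries.coeff_subst_single, h1, h2]
  simp only [Finsupp.embDomain_inj]

theorem prod_filter_lt {M : Type*} [CommMonoid M] (N : ℕ) (f : ℕ → ℕ → M) :
    ∏ ij ∈ (Finset.range N ×ˢ Finset.range N).filter (fun ij => ij.1 < ij.2), f ij.1 ij.2
      = ∏ i : Fin N, ∏ j ∈ Finset.Ioi i, f i j := by
  rw [Finset.prod_filter, Finset.prod_product, Finset.prod_range]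
  refine Finset.prod_congr rfl fun i _ => ?_
  rw [Finset.prod_range, ← Finset.filter_lt_eq_Ioi, Finset.prod_filter]
  rfl

theorem truncVars_kappa_mul (N : ℕ) (p : PowerSeries K)
    (hp : PowerSeries.constantCoeff p = 1) :
    truncVars K N (kappa p) * ∏ i : Fin N, ∏ j ∈ Finset.Ioi i,
        (1 - MvPowerSeries.X i * MvPowerSeries.X j : MvPowerSeries (Fin N) K)
      = ∏ i : Fin N, p.subst (MvPowerSeries.X i : MvPowerSeries (Fin N) K) := by
  have h1 : truncVars K N (kappa p) = truncVars K N (kappaFin p (Finset.range N)) := by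
    ext e
    rw [coeff_truncVars, coeff_truncVars, coeff_kappaSeries p hp]
    · rfl
    · rw [Finsupp.support_embDomain]
      intro k hk
      obtain ⟨i, -, rfl⟩ := Finset.mem_map.mp hk
      exact Finset.mem_range.mpr i.isLt
  have h2 : ∏ i : Fin N, ∏ j ∈ Finset.Ioi i,
      (1 - MvPowerSeries.X i * MvPowerSeries.X j : MvPowerSeries (Fin N) K)
      = truncVars K N (∏ ij ∈ (Finset.range N ×ˢ Finset.range N).filter (fun ij => ij.1 < ij.2),
        (1 - MvPowerSeries.X ij.1 * MvPowerSeries.X ij.2 : MvPowerSeries ℕ K)) := by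
    rw [prod_filter_lt N fun i j => (1 - MvPowerSeries.X i * MvPowerSeries.X j :
      MvPowerSeries ℕ K)]
    simp only [map_prod, map_sub, map_one, map_mul, truncVars_X]
  rw [h1, h2, ← map_mul, kappaFin, mul_assoc, MvPowerSeries.inv_mul_cancel, mul_one, map_prod,
    Finset.prod_range]
  · exact Finset.prod_congr rfl fun i _ => truncVars_subst_X N p i
  · rw [constantCoeff_den]
    exact one_ne_zero

end Kappa

/-! ### The key identity for κ_p and the series pH. -/

section Twisted

variable {K : Type*} [Field K]

instance [CharZero K] : CharZero (Lambda K) :=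
  charZero_of_injective_algebraMap (algebraMap K (Lambda K)).injective

/-- The product of `p` and the generating series of the complete homogeneous functions. -/
def twistedSeries (p : PowerSeries K) : PowerSeries (Lambda K) :=
  PowerSeries.map (algebraMap K (Lambda K)) p * hSeries K

theorem coeff_twistedSeries (p : PowerSeries K) (n : ℕ) :
    PowerSeries.coeff n (twistedSeries p)
      = ∑ i ∈ Finset.range (n + 1), PowerSeries.coeff i p • h K (n - i) := by
  rw [twistedSeries, PowerSeries.coeff_mul, Finset.Nat.sum_antidiagonal_eq_sum_range_succ
    (fun i j => PowerSeries.coeff i (PowerSeries.map (algebraMap K (Lambda K)) p)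
      * PowerSeries.coeff j (hSeries K))]
  refine Finset.sum_congr rfl fun i _ => ?_
  rw [PowerSeries.coeff_map, hSeries, PowerSeries.coeff_mk, Algebra.smul_def]

theorem constantCoeff_twistedSeries (p : PowerSeries K)
    (hp : PowerSeries.constantCoeff p = 1) :
    PowerSeries.constantCoeff (twistedSeries p) = 1 := by
  rw [twistedSeries, map_mul, constantCoeff_hSeries, mul_one,
    ← PowerSeries.coeff_zero_eq_constantCoeff_apply, PowerSeries.coeff_map,
    PowerSeries.coeff_zero_eq_constantCoeff_apply, hp, map_one]

theorem map_subst_X {R S σ : Type*} [CommRing R] [CommRing S] (φ : R →+* S)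
    (p : PowerSeries R) (i : σ) :
    MvPowerSeries.map φ (p.subst (MvPowerSeries.X i : MvPowerSeries σ R))
      = (PowerSeries.map φ p).subst (MvPowerSeries.X i : MvPowerSeries σ S) := by
  classical
  ext d
  rw [MvPowerSeries.coeff_map, PowerSeries.coeff_subst_single, PowerSeries.coeff_subst_single,
    PowerSeries.coeff_map]
  split_ifs
  · rfl
  · exact map_zero φ

/-- Multiplying the symplectic alternant by `κ_p` gives the ordinary alternant of the
twisted series. -/
theorem kappa_mul_alternant (N : ℕ) (p : PowerSeries K)
    (hp : PowerSeries.constantCoeff p = 1) :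
    MvPowerSeries.map (algebraMap K (Lambda K)) (truncVars K N (kappa p))
        * alternant (fun j : Fin N => symplecticFamily (Lambda K) N j * hSeries K)
      = alternant (fun j : Fin N => PowerSeries.X ^ (j.rev : ℕ) * twistedSeries p) := by
  have h1 := congrArg (MvPowerSeries.map (algebraMap K (Lambda K))) (truncVars_kappa_mul N p hp)
  simp only [map_mul, map_prod, map_sub, map_one, MvPowerSeries.map_X, map_subst_X] at h1
  have h2 : ∀ i : Fin N, (twistedSeries p).subst
      (MvPowerSeries.X i : MvPowerSeries (Fin N) (Lambda K))
      = (PowerSeries.map (algebraMap K (Lambda K)) p).subst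
          (MvPowerSeries.X i : MvPowerSeries (Fin N) (Lambda K))
        * (hSeries K).subst (MvPowerSeries.X i : MvPowerSeries (Fin N) (Lambda K)) := fun i =>
    PowerSeries.subst_mul (PowerSeries.HasSubst.X i) _ _
  rw [alternant_mul, alternant_mul]
  change _ * (_ * alternant (symplecticFamily (Lambda K) N))
    = _ * vandermondeAlternant (Lambda K) N
  rw [alternant_symplecticFamily, Finset.prod_congr rfl fun i _ => h2 i,
    Finset.prod_mul_distrib, ← h1]
  ring

variable [CharZero K]

/-- The heart of the proof: both sides are the coefficient of y^(μ+δ) in κ_p(y) times the symplectic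
alternant of H. -/
theorem schurToSp_skewing_kappa (p : PowerSeries K) (hp : PowerSeries.constantCoeff p = 1)
    (N : ℕ) (μ : YoungDiagram) (hμ : μ.card ≤ N) :
    schurToSp (schurBasis K) (skewing (kappa p) (schur K μ))
      = jacobiTrudi (twistedSeries p) N μ := by
  classical
  set n := μ.card
  have hcolμ := (colLen_le_card μ).trans hμ
  have hcol : ∀ ν ∈ diagramsLE n, ν.colLen 0 ≤ N := fun ν hν =>
    (colLen_le_card ν).trans ((mem_diagramsLE.mp hν).trans hμ)
  set W := alternant (fun j : Fin N => symplecticFamily (Lambda K) N j * hSeries K)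
  have hW : IsAntisymm W := isAntisymm_alternant _
  -- Up to degree |μ| + |δ| the alternant `W` may be replaced by the finite sum of the sp_ν a_{ν+δ}.
  rw [← coeff_expo_alternant_X_pow_mul, ← kappa_mul_alternant N p hp,
    coeff_mul_eq_of_coeff_eq _ W
      (∑ ν ∈ diagramsLE n, sp K ν • schurAlternant (Lambda K) N ν), skewing_schur, map_sum,
    Finset.mul_sum, map_sum]
  · refine Finset.sum_congr rfl fun ν hν => ?_
    rw [map_smul, schurToSp, ← schurBasis_apply K ν, Module.Basis.constr_basis,
      schurBasis_apply, pairing_schur N μ hμ, mul_smul_comm, MvPowerSeries.coeff_smul,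
      Algebra.smul_def, mul_comm]
    congr 1
    -- As a_{ν+δ} = a_δ s_ν(y), the coefficient of κ_p a_{ν+δ} at μ+δ is ⟨s_μ, κ_p s_ν⟩.
    rw [← map_schurAlternant (algebraMap K (Lambda K)), ← map_mul, MvPowerSeries.coeff_map,
      schurCoeff_apply, MulMemClass.coe_mul, map_mul (truncVars K N), coe_toHat,
      ← vandermondeAlternant_mul_truncVars_schur N ν (hcol ν hν), mul_left_comm]
  · intro e he
    rw [degree_expo N μ hcolμ] at he
    rw [hW.coeff_eq_sum n hμ e he, map_sum]
    refine Finset.sum_congr rfl fun ν hν => ?_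
    rw [MvPowerSeries.coeff_smul, sp_eq_symplecticDet K N ν (hcol ν hν),
      ← coeff_expo_alternant_symplecticFamily_mul]

end Twisted

/-! ### Λ as a polynomial ring in the h_n, and the automorphism H ↦ pH. -/

section Generators

variable (K : Type*) [Field K]

/-- The algebra homomorphism sending the variables to the complete homogeneous functions. -/
def evalH : MvPolynomial ℕ K →ₐ[K] Lambda K := MvPolynomial.aeval fun n => h K (n + 1)

/-- The series `1 + X_0 t + X_1 t² + ⋯` with indeterminate coefficients. -/
def genericSeries : PowerSeries (MvPolynomial ℕ K) :=
  PowerSeries.mk fun n => if n = 0 then 1 else MvPolynomial.X (n - 1)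

theorem constantCoeff_genericSeries : PowerSeries.constantCoeff (genericSeries K) = 1 := by
  rw [← PowerSeries.coeff_zero_eq_constantCoeff_apply, genericSeries, PowerSeries.coeff_mk,
    if_pos rfl]

theorem map_genericSeries :
    PowerSeries.map (evalH K).toRingHom (genericSeries K) = hSeries K := by
  ext1 n
  rw [PowerSeries.coeff_map, genericSeries, PowerSeries.coeff_mk, hSeries, PowerSeries.coeff_mk]
  rcases n with _ | n
  · simp [h_zero]
  · simp [evalH]

/-- The Jacobi-Trudi determinant with indeterminate entries. -/
def genericSchur (μ : YoungDiagram) : MvPolynomial ℕ K :=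
  jacobiTrudi (genericSeries K) (μ.colLen 0) μ

theorem evalH_genericSchur (μ : YoungDiagram) : evalH K (genericSchur K μ) = schur K μ := by
  rw [schur_eq_jacobiTrudi K _ μ le_rfl, ← map_genericSeries, ← map_jacobiTrudi]
  rfl

variable [CharZero K]

/-- Cancelling a_δ in the Cauchy identity for the generic series G gives ∏ G(y_i) = ∑ S_ν s_ν(y) up
to degree N, where S_ν are the generic Schur polynomials. The product in question is a coefficient
of the left side. -/
theorem coeff_prod_genericSeries_mem_span (N : ℕ) (d : Fin N →₀ ℕ) (hd : d.degree ≤ N) :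
    ∏ i, PowerSeries.coeff (d i) (genericSeries K)
      ∈ Submodule.span K (Set.range (genericSchur K)) := by
  set G := ∏ i : Fin N, (genericSeries K).subst
    (MvPowerSeries.X i : MvPowerSeries (Fin N) (MvPolynomial ℕ K)) with hG
  have hW : vandermondeAlternant (MvPolynomial ℕ K) N * G
      = alternant fun j : Fin N => PowerSeries.X ^ (j.rev : ℕ) * genericSeries K := by
    rw [alternant_mul, mul_comm]
    rfl
  have hcol : ∀ ν ∈ diagramsLE N, ν.colLen 0 ≤ N := fun ν hν =>
    (colLen_le_card ν).trans (mem_diagramsLE.mp hν)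
  have key := coeff_eq_zero_of_vandermondeAlternant_mul (G - ∑ ν ∈ diagramsLE N,
    genericSchur K ν • MvPowerSeries.map (algebraMap K (MvPolynomial ℕ K))
      (truncVars K N (schur K ν))) N (fun e he => by
    rw [mul_sub, hW, map_sub, (isAntisymm_alternant _).coeff_eq_sum N le_rfl e he, sub_eq_zero,
      Finset.mul_sum, map_sum]
    refine Finset.sum_congr rfl fun ν hν => ?_
    have hs : vandermondeAlternant (MvPolynomial ℕ K) N * MvPowerSeries.map
        (algebraMap K (MvPolynomial ℕ K)) (truncVars K N (schur K ν))
        = schurAlternant (MvPolynomial ℕ K) N ν := by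
      rw [← map_schurAlternant (algebraMap K (MvPolynomial ℕ K)) ν,
        ← vandermondeAlternant_mul_truncVars_schur N ν (hcol ν hν), map_mul,
        ← schurAlternant_bot, ← schurAlternant_bot, map_schurAlternant]
    rw [mul_smul_comm, MvPowerSeries.coeff_smul, coeff_expo_alternant_X_pow_mul,
      jacobiTrudi_stable _ (constantCoeff_genericSeries K) N ν (hcol ν hν), hs]
    rfl) d hd
  rw [map_sub, sub_eq_zero, hG, coeff_prod_subst_X, map_sum] at key
  rw [key]
  refine sum_mem fun ν _ => ?_
  rw [MvPowerSeries.coeff_smul, MvPowerSeries.coeff_map, mul_comm, ← Algebra.smul_def]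
  exact Submodule.smul_mem _ _ (Submodule.subset_span ⟨ν, rfl⟩)

theorem span_genericSchur : Submodule.span K (Set.range (genericSchur K)) = ⊤ := by
  have hmon : ∀ m : ℕ →₀ ℕ, ∃ (M : ℕ) (α : ℕ → ℕ), MvPolynomial.monomial m (1 : K)
      = ∏ i ∈ Finset.range M, PowerSeries.coeff (α i) (genericSeries K) := by
    intro m
    induction m using Finsupp.induction_linear with
    | zero => exact ⟨0, 0, by simp⟩
    | add m₁ m₂ h₁ h₂ =>
      obtain ⟨M₁, α₁, e₁⟩ := h₁
      obtain ⟨M₂, α₂, e₂⟩ := h₂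
      refine ⟨M₁ + M₂, fun i => if i < M₁ then α₁ i else α₂ (i - M₁), ?_⟩
      rw [← mul_one (1 : K), ← MvPolynomial.monomial_mul, e₁, e₂, Finset.prod_range_add]
      congr 1
      · refine Finset.prod_congr rfl fun i hi => ?_
        simp [Finset.mem_range.mp hi]
      · refine Finset.prod_congr rfl fun i _ => ?_
        simp
    | single k a =>
      refine ⟨a, fun _ => k + 1, ?_⟩
      simp [genericSeries, MvPolynomial.X_pow_eq_monomial]
  rw [eq_top_iff]
  rintro f -
  rw [f.as_sum]
  refine sum_mem fun m _ => ?_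
  obtain ⟨M, α, hα⟩ := hmon m
  rw [← mul_one (MvPolynomial.coeff m f), ← smul_eq_mul, ← MvPolynomial.smul_monomial, hα]
  refine Submodule.smul_mem _ _ ?_
  -- Padding by the constant coefficient 1 leaves the product unchanged and makes the number of
  -- variables at least the degree.
  let β : ℕ → ℕ := fun i => if i < M then α i else 0
  have hβ : ∀ i ∈ Finset.range M, β i = α i := fun i hi => if_pos (Finset.mem_range.mp hi)
  have hβ' : ∀ i, β (M + i) = 0 := fun i => if_neg (by omega)
  have key := coeff_prod_genericSeries_mem_span K (M + ∑ i ∈ Finset.range M, α i)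
    (Finsupp.equivFunOnFinite.symm fun i => β i) (by
      rw [Finsupp.degree_eq_sum]
      simp only [Finsupp.equivFunOnFinite_symm_apply_apply]
      rw [Fin.sum_univ_eq_sum_range β, Finset.sum_range_add, Finset.sum_congr rfl hβ]
      simp [hβ'])
  simp only [Finsupp.equivFunOnFinite_symm_apply_apply] at key
  rw [Fin.prod_univ_eq_prod_range (fun i => PowerSeries.coeff (β i) (genericSeries K)),
    Finset.prod_range_add, Finset.prod_congr rfl fun i hi => by rw [hβ i hi]] at key
  simpa [hβ', constantCoeff_genericSeries] using key

/-- The map s_μ ↦ generic Schur polynomial is a right inverse of `evalH` and is itself surjective,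
which forces injectivity of `evalH`. -/
theorem evalH_bijective : Function.Bijective (evalH K) := by
  let Ψ : Lambda K →ₗ[K] MvPolynomial ℕ K := (schurBasis K).constr K (genericSchur K)
  have h1 : ∀ f, evalH K (Ψ f) = f := by
    intro f
    have : (evalH K).toLinearMap ∘ₗ Ψ = LinearMap.id := by
      refine (schurBasis K).ext fun μ => ?_
      rw [LinearMap.comp_apply, Module.Basis.constr_basis, LinearMap.id_apply, schurBasis_apply]
      exact evalH_genericSchur K μ
    exact LinearMap.congr_fun this f
  have h2 : Function.Surjective Ψ := by
    rw [← LinearMap.range_eq_top, Module.Basis.constr_range, span_genericSchur]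
  refine ⟨fun x y hxy => ?_, fun f => ⟨Ψ f, h1 f⟩⟩
  obtain ⟨a, rfl⟩ := h2 x
  obtain ⟨b, rfl⟩ := h2 y
  rw [h1, h1] at hxy
  rw [hxy]

/-- The ring of symmetric functions is the polynomial ring in `h_1, h_2, …`. -/
def polynomialEquiv : MvPolynomial ℕ K ≃ₐ[K] Lambda K :=
  AlgEquiv.ofBijective (evalH K) (evalH_bijective K)

variable {K}

theorem polynomialEquiv_X (n : ℕ) : polynomialEquiv K (MvPolynomial.X n) = h K (n + 1) := by
  simp [polynomialEquiv, evalH]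

theorem algHom_ext_h {B : Type*} [Semiring B] [Algebra K B] {F G : Lambda K →ₐ[K] B}
    (hFG : ∀ n, F (h K n) = G (h K n)) : F = G := by
  have h1 : F.comp (polynomialEquiv K).toAlgHom = G.comp (polynomialEquiv K).toAlgHom := by
    refine MvPolynomial.algHom_ext fun n => ?_
    change F (polynomialEquiv K (MvPolynomial.X n)) = G (polynomialEquiv K (MvPolynomial.X n))
    rw [polynomialEquiv_X, hFG]
  refine AlgHom.ext fun f => ?_
  obtain ⟨x, rfl⟩ := (polynomialEquiv K).surjective f
  exact DFunLike.congr_fun h1 x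

/-- The endomorphism of the ring of symmetric functions with `H(t) ↦ p(t) H(t)`. -/
def twist (p : PowerSeries K) : Lambda K →ₐ[K] Lambda K :=
  (MvPolynomial.aeval fun n => PowerSeries.coeff (n + 1) (twistedSeries p)).comp
    (polynomialEquiv K).symm.toAlgHom

theorem twist_h (p : PowerSeries K) (hp : PowerSeries.constantCoeff p = 1) (n : ℕ) :
    twist p (h K n) = PowerSeries.coeff n (twistedSeries p) := by
  rcases n with _ | n
  · rw [h_zero, map_one, PowerSeries.coeff_zero_eq_constantCoeff_apply,
      constantCoeff_twistedSeries p hp]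
  · rw [← polynomialEquiv_X]
    simp [twist]

theorem map_twist_hSeries (p : PowerSeries K) (hp : PowerSeries.constantCoeff p = 1) :
    PowerSeries.map (twist p).toRingHom (hSeries K) = twistedSeries p := by
  ext1 n
  rw [PowerSeries.coeff_map, hSeries, PowerSeries.coeff_mk]
  exact twist_h p hp n

/-- The coefficients of p are scalars, hence fixed, so the composite sends H to pqH = H. -/
theorem twist_comp_twist (p q : PowerSeries K) (hp : PowerSeries.constantCoeff p = 1)
    (hq : PowerSeries.constantCoeff q = 1) (hpq : p * q = 1) :
    (twist q).comp (twist p) = AlgHom.id K (Lambda K) := by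
  have h1 : PowerSeries.map (twist q).toRingHom (twistedSeries p) = hSeries K := by
    have h2 : PowerSeries.map (twist q).toRingHom (PowerSeries.map (algebraMap K (Lambda K)) p)
        = PowerSeries.map (algebraMap K (Lambda K)) p := by
      ext1 n
      rw [PowerSeries.coeff_map, PowerSeries.coeff_map]
      exact (twist q).commutes _
    rw [twistedSeries, map_mul, h2, map_twist_hSeries q hq, twistedSeries, ← mul_assoc, ← map_mul,
      hpq, map_one, one_mul]
  refine algHom_ext_h fun n => ?_
  rw [AlgHom.comp_apply, twist_h p hp, AlgHom.id_apply]
  have h3 := congrArg (PowerSeries.coeff n) h1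
  rwa [PowerSeries.coeff_map, hSeries, PowerSeries.coeff_mk] at h3

/-- The automorphism of the ring of symmetric functions with `H(t) ↦ p(t) H(t)`. -/
def twistEquiv (p : PowerSeries K) (hp : PowerSeries.constantCoeff p = 1) :
    Lambda K ≃ₐ[K] Lambda K :=
  have hmul : p * p⁻¹ = 1 := PowerSeries.mul_inv_cancel p (by rw [hp]; exact one_ne_zero)
  have hinv : PowerSeries.constantCoeff p⁻¹ = 1 := by
    rw [PowerSeries.constantCoeff_inv, hp, inv_one]
  AlgEquiv.ofAlgHom (twist p) (twist p⁻¹)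
    (twist_comp_twist p⁻¹ p hinv hp (by rw [mul_comm, hmul]))
    (twist_comp_twist p p⁻¹ hp hinv hmul)

theorem twistEquiv_apply (p : PowerSeries K) (hp : PowerSeries.constantCoeff p = 1)
    (u : Lambda K) : twistEquiv p hp u = twist p u := rfl

/-- On s_μ both maps give the Jacobi-Trudi determinant of pH. -/
theorem twist_eq_schurToSp (p : PowerSeries K) (hp : PowerSeries.constantCoeff p = 1)
    (u : Lambda K) :
    twist p u = schurToSp (schurBasis K) (skewing (kappa p) u) := by
  have key : (twist p).toLinearMap = schurToSp (schurBasis K) ∘ₗ skewing (kappa p) := by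
    refine (schurBasis K).ext fun μ => ?_
    rw [schurBasis_apply, LinearMap.comp_apply, schurToSp_skewing_kappa p hp _ μ le_rfl,
      schur_eq_jacobiTrudi K _ μ (colLen_le_card μ), ← map_twist_hSeries p hp,
      ← map_jacobiTrudi]
    rfl
  exact LinearMap.congr_fun key u

end Generators

end SymFun

end

theorem mainTheorem2 (K : Type*) [Field K] [CharZero K] :
    ∃ s : Module.Basis YoungDiagram K (SymFun.Lambda K),
      (∀ μ : YoungDiagram, s μ = SymFun.schur K μ) ∧
      ∀ p : PowerSeries K, PowerSeries.constantCoeff p = 1 →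
        ∃ A : SymFun.Lambda K →ₗ[K] SymFun.Lambda K,
          SymFun.IsSkewing s (SymFun.kappa p) A ∧
          (∀ B : SymFun.Lambda K →ₗ[K] SymFun.Lambda K,
            SymFun.IsSkewing s (SymFun.kappa p) B → B = A) ∧
          ∃ F : SymFun.Lambda K ≃ₐ[K] SymFun.Lambda K,
            (∀ u : SymFun.Lambda K, F u = SymFun.schurToSp s (A u)) ∧
            (∀ n : ℕ, F (SymFun.h K n) =
              ∑ i ∈ Finset.range (n + 1), PowerSeries.coeff i p • SymFun.h K (n - i)) ∧
            ∀ G : SymFun.Lambda K →ₐ[K] SymFun.Lambda K,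
              (∀ n : ℕ, G (SymFun.h K n) =
                ∑ i ∈ Finset.range (n + 1), PowerSeries.coeff i p • SymFun.h K (n - i)) →
              ∀ u : SymFun.Lambda K, G u = F u := by
  have hF : ∀ p : PowerSeries K, PowerSeries.constantCoeff p = 1 → ∀ n, SymFun.twist p
      (SymFun.h K n) = ∑ i ∈ Finset.range (n + 1), PowerSeries.coeff i p • SymFun.h K (n - i) :=
    fun p hp n => (SymFun.twist_h p hp n).trans (SymFun.coeff_twistedSeries p n)
  refine ⟨SymFun.schurBasis K, SymFun.schurBasis_apply K, fun p hp =>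
    ⟨SymFun.skewing (SymFun.kappa p), SymFun.isSkewing_skewing _,
      fun B hB => (SymFun.isSkewing_skewing _).unique hB,
      SymFun.twistEquiv p hp, SymFun.twist_eq_schurToSp p hp, hF p hp, fun G hG u => ?_⟩⟩
  rw [SymFun.twistEquiv_apply, SymFun.algHom_ext_h (F := G) fun n => (hG n).trans (hF p hp n).symm]
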